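/- Let $(M,g)$ be a smooth Riemannian surface, $I\subset\mathbb{R}$ a non-degenerate interval, and $\gamma\colon I\to M$ a smooth curve parametrized by arclength, with $T=\gamma'$. The geodesic curvature $k\colon I\to\mathbb{R}$ of $\gamma$ is defined, up to the choice of a smooth unit normal field $N$ along $\gamma$, by $\nabla_TT=kN$. With $\tau=\nabla_TT$ and $R(X,Y)Z=\nabla_X\nabla_YZ-\nabla_Y\nabla_XZ-\nabla_{[X,Y]}Z$, the curve $\gamma$ is called *$\tfrac12$-biharmonic* if $\tau$ vanishes nowhere and $\gamma$ satisfies the Euler–Lagrange equation $$\nabla_T\nabla_T\big(|\tau|^{-3/2}\tau\big)-|\tau|^{-3/2}R(T,\tau)T=0$$ of the energy $2\int_I|\nabla_{\gamma'}\gamma'|^{1/2}\,ds$; it is called *proper $\tfrac12$-biharmonic* if in addition its geodesic curvature is not constant. **Theorem.** 1. If $M=\mathbb{R}^2$ with the flat metric ($K=0$), then $\gamma$ is proper $\tfrac12$-biharmonic if its geodesic curvature (for some choice of $N$) is $$k(s)=\frac{c_1}{c_1^2(c_2+s)^2+1},\qquad c_1,c_2\in\mathbb{R},\ c_1\neq0.$$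 2. If $M=\mathbb{S}^2$ with the round metric of curvature $K=1$, then $\gamma$ is proper $\tfrac12$-biharmonic if its geodesic curvature is $$k(s)=\frac{2}{c_1+\sqrt{c_1^2-4}\,\sin 2(c_3+s)},\qquad c_1,c_3\in\mathbb{R},\ c_1^2>4.$$ 3. If $M$ is a surface with a metric of constant Gauss curvature $K=-1$, then $\gamma$ is proper $\tfrac12$-biharmonic if its geodesic curvature is $$k(s)=\frac{4e^{2(c_4+s)}}{(c_1-e^{2(c_4+s)})^2+4},\qquad c_1,c_4\in\mathbb{R}.$$ Moreover, in each case the function $k$, considered on all of $\mathbb{R}$, is smooth and solves $\tfrac34k'^2-\tfrac12kk''-k^4+Kk^2=0$ with the respective value of $K$. -/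

import Mathlib

open scoped Manifold ContDiff

universe u

noncomputable section

/-! ### Riemannian metrics -/

/-- A smooth Riemannian metric on an `n`-dimensional smooth manifold `M` without boundary. -/
abbrev SmoothRiemannianMetric (n : ℕ) (M : Type*) [TopologicalSpace M]
    [ChartedSpace (EuclideanSpace ℝ (Fin n)) M] [IsManifold (𝓡 n) ∞ M] :=
  Bundle.ContMDiffRiemannianMetric (𝓡 n) ∞ (EuclideanSpace ℝ (Fin n))
    (fun x : M => TangentSpace (𝓡 n) x)

/-- The flat metric of the Euclidean plane. -/
def flatMetric : SmoothRiemannianMetric 2 (EuclideanSpace ℝ (Fin 2)) where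
  inner _ := (innerSL ℝ : EuclideanSpace ℝ (Fin 2) →L[ℝ] EuclideanSpace ℝ (Fin 2) →L[ℝ] ℝ)
  symm := (riemannianMetricVectorSpace (EuclideanSpace ℝ (Fin 2))).symm
  pos := (riemannianMetricVectorSpace (EuclideanSpace ℝ (Fin 2))).pos
  isVonNBounded := (riemannianMetricVectorSpace (EuclideanSpace ℝ (Fin 2))).isVonNBounded
  contMDiff :=
    (riemannianMetricVectorSpace (EuclideanSpace ℝ (Fin 2))).contMDiff.of_le (by simp)

/-- The unit sphere `S²` in `ℝ³`. -/
abbrev TwoSphere := Metric.sphere (0 : EuclideanSpace ℝ (Fin 3)) 1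

/-- The differential at `x` of the inclusion of `S²` into `ℝ³`. -/
def sphereInclusionDeriv (x : TwoSphere) :
    TangentSpace (𝓡 2) x →L[ℝ] EuclideanSpace ℝ (Fin 3) :=
  mvfderiv (𝓡 2) (fun y : TwoSphere => (y : EuclideanSpace ℝ (Fin 3))) x

/-- The bilinear form `(v, w) ↦ ⟪A v, A w⟫`. -/
def pullbackInner (A : EuclideanSpace ℝ (Fin 2) →L[ℝ] EuclideanSpace ℝ (Fin 3)) :
    EuclideanSpace ℝ (Fin 2) →L[ℝ] EuclideanSpace ℝ (Fin 2) →L[ℝ] ℝ :=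
  (innerSL ℝ : EuclideanSpace ℝ (Fin 3) →L[ℝ] EuclideanSpace ℝ (Fin 3) →L[ℝ] ℝ).bilinearComp A A

theorem contDiff_pullbackInner : ContDiff ℝ ∞ pullbackInner := by
  have : pullbackInner = fun A => ((ContinuousLinearMap.compL ℝ _ _ _).flip A) ∘L
      ((innerSL ℝ : EuclideanSpace ℝ (Fin 3) →L[ℝ] EuclideanSpace ℝ (Fin 3) →L[ℝ] ℝ) ∘L A) := by
    rfl
  rw [this]
  fun_prop

theorem sphereInclusionDeriv_injective (x : TwoSphere) :
    Function.Injective (sphereInclusionDeriv x) := by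
  have := Fact.mk (@finrank_euclideanSpace_fin ℝ _ (2 + 1))
  exact injective_mvfderiv_subtypeVal_sphere (n := 2) x

/-- The inner product on the tangent space of `S²` at `x` induced from `ℝ³`. -/
def roundInner (x : TwoSphere) :
    TangentSpace (𝓡 2) x →L[ℝ] TangentSpace (𝓡 2) x →L[ℝ] ℝ :=
  pullbackInner (sphereInclusionDeriv x)

/-- The round metric of `S²`: the metric induced from the Euclidean metric of `ℝ³`. -/
def roundMetric : SmoothRiemannianMetric 2 TwoSphere where
  inner := roundInner
  symm x v w := real_inner_comm (sphereInclusionDeriv x w) (sphereInclusionDeriv x v)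
  pos x v hv := real_inner_self_pos.2
    (fun h => hv (sphereInclusionDeriv_injective x (h.trans (map_zero _).symm)))
  isVonNBounded x := by
    let A : EuclideanSpace ℝ (Fin 2) →L[ℝ] EuclideanSpace ℝ (Fin 3) := sphereInclusionDeriv x
    obtain ⟨K, hK, hA⟩ := A.toLinearMap.exists_antilipschitzWith
      (LinearMap.ker_eq_bot.2 (sphereInclusionDeriv_injective x))
    have : {v : EuclideanSpace ℝ (Fin 2) | inner ℝ (A v) (A v) < 1} ⊆ Metric.closedBall 0 K := by
      intro v h1
      rw [Set.mem_ofPred_eq, real_inner_self_eq_norm_sq] at h1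
      have h2 : ‖A v‖ ≤ 1 := by nlinarith [norm_nonneg (A v)]
      have h3 : dist v 0 ≤ K * dist (A v) (A 0) := hA.le_mul_dist v 0
      rw [map_zero, dist_zero_right, dist_zero_right] at h3
      have h4 : (K : ℝ) * ‖A v‖ ≤ K * 1 := by gcongr
      rw [mem_closedBall_zero_iff]
      linarith
    have h := (NormedSpace.isVonNBounded_closedBall ℝ (EuclideanSpace ℝ (Fin 2)) K).subset this
    exact h
  contMDiff := by
    intro x
    rw [Bundle.contMDiffAt_section]
    have := Fact.mk (@finrank_euclideanSpace_fin ℝ _ (2 + 1))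
    have h := (contMDiff_coe_sphere (n := 2) (m := ∞)
      (E := EuclideanSpace ℝ (Fin 3)) x).mfderiv_const (m := ∞) (by simp)
    refine (contDiff_pullbackInner.contMDiff.contMDiffAt.comp x h).congr_of_eventuallyEq ?_
    have hU : (trivializationAt (EuclideanSpace ℝ (Fin 2) →L[ℝ] ℝ)
        (fun x : TwoSphere => TangentSpace (𝓡 2) x →L[ℝ] ℝ) x).baseSet ∈ nhds x :=
      (trivializationAt (EuclideanSpace ℝ (Fin 2) →L[ℝ] ℝ)
        (fun x : TwoSphere => TangentSpace (𝓡 2) x →L[ℝ] ℝ) x).open_baseSet.mem_nhds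
        (FiberBundle.mem_baseSet_trivializationAt' x)
    filter_upwards [hU] with y hy
    ext v w
    rw [hom_trivializationAt_apply, ContinuousLinearMap.inCoordinates]
    simp only [ContinuousLinearMap.comp_apply]
    rw [Bundle.Trivialization.continuousLinearMapAt_apply,
      Bundle.Trivialization.linearMapAt_apply, if_pos hy, hom_trivializationAt_apply,
      ContinuousLinearMap.inCoordinates]
    simp [inTangentCoordinates, ContinuousLinearMap.inCoordinates, pullbackInner]
    rfl

/-! ### Levi-Civita connection and curvature in a chart

Here `φ` is a chart of `M`; the functions below are meaningful at points `y` of its target. -/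

section Charts

variable {n : ℕ} {M : Type u} [TopologicalSpace M] [ChartedSpace (EuclideanSpace ℝ (Fin n)) M]
  [IsManifold (𝓡 n) ∞ M]

/-- The partial derivative `∂ᵢ f` at `y`. -/
def partialDeriv (i : Fin n) (f : EuclideanSpace ℝ (Fin n) → ℝ) (y : EuclideanSpace ℝ (Fin n)) :
    ℝ :=
  fderiv ℝ f y (EuclideanSpace.single i 1)

/-- The coordinate vector field `∂ᵢ` of the chart `φ`, at the point with coordinates `y`. -/
def coordField (φ : OpenPartialHomeomorph M (EuclideanSpace ℝ (Fin n)))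
    (y : EuclideanSpace ℝ (Fin n)) (i : Fin n) : TangentSpace (𝓡 n) (φ.symm y) :=
  mfderiv (𝓡 n) (𝓡 n) φ.symm y (EuclideanSpace.single i (1 : ℝ) : EuclideanSpace ℝ (Fin n))

/-- The coefficients `gᵢⱼ = g(∂ᵢ, ∂ⱼ)` of the metric in the chart `φ`. -/
def metricCoeff (g : SmoothRiemannianMetric n M)
    (φ : OpenPartialHomeomorph M (EuclideanSpace ℝ (Fin n))) (y : EuclideanSpace ℝ (Fin n)) :
    Matrix (Fin n) (Fin n) ℝ :=
  Matrix.of fun i j => g.inner (φ.symm y) (coordField φ y i) (coordField φ y j)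

/-- The Christoffel symbols of the Levi-Civita connection,
`Γᵏᵢⱼ = ½ ∑ₗ gᵏˡ (∂ᵢ gⱼₗ + ∂ⱼ gᵢₗ - ∂ₗ gᵢⱼ)`. -/
def christoffel (g : SmoothRiemannianMetric n M)
    (φ : OpenPartialHomeomorph M (EuclideanSpace ℝ (Fin n))) (k i j : Fin n)
    (y : EuclideanSpace ℝ (Fin n)) : ℝ :=
  1 / 2 * ∑ l, (metricCoeff g φ y)⁻¹ k l *
    (partialDeriv i (fun z => metricCoeff g φ z j l) y
      + partialDeriv j (fun z => metricCoeff g φ z i l) y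
      - partialDeriv l (fun z => metricCoeff g φ z i j) y)

/-- The components of the Riemann curvature tensor
`R(X, Y) Z = ∇_X ∇_Y Z - ∇_Y ∇_X Z - ∇_[X, Y] Z`, normalised by `R(∂ᵢ, ∂ⱼ) ∂ₖ = ∑ₗ Rˡᵢⱼₖ ∂ₗ`. -/
def riemannCoeff (g : SmoothRiemannianMetric n M)
    (φ : OpenPartialHomeomorph M (EuclideanSpace ℝ (Fin n))) (l i j k : Fin n)
    (y : EuclideanSpace ℝ (Fin n)) : ℝ :=
  partialDeriv i (christoffel g φ l j k) y - partialDeriv j (christoffel g φ l i k) y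
    + ∑ m, (christoffel g φ l i m y * christoffel g φ m j k y
      - christoffel g φ l j m y * christoffel g φ m i k y)

/-- The components of `R(X, Y) Z` for vectors `X`, `Y`, `Z` given by their components. -/
def riemannApply (g : SmoothRiemannianMetric n M)
    (φ : OpenPartialHomeomorph M (EuclideanSpace ℝ (Fin n))) (y : EuclideanSpace ℝ (Fin n))
    (X Y Z : Fin n → ℝ) : Fin n → ℝ :=
  fun l => ∑ i, ∑ j, ∑ k, riemannCoeff g φ l i j k y * X i * Y j * Z k

/-- The length of the vector with components `V`. -/
def coordNorm (g : SmoothRiemannianMetric n M)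
    (φ : OpenPartialHomeomorph M (EuclideanSpace ℝ (Fin n))) (y : EuclideanSpace ℝ (Fin n))
    (V : Fin n → ℝ) : ℝ :=
  Real.sqrt (∑ i, ∑ j, metricCoeff g φ y i j * V i * V j)

/-! ### Curves

A curve is a map `γ : ℝ → M` considered on an interval `I`; all derivatives with respect to the
curve parameter are derivatives within `I`. -/

/-- The velocity `γ'(s)`. -/
def velocity (γ : ℝ → M) (I : Set ℝ) (s : ℝ) : TangentSpace (𝓡 n) (γ s) :=
  mfderivWithin 𝓘(ℝ, ℝ) (𝓡 n) γ I s (1 : ℝ)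

/-- `γ` is a smooth curve on the (non-degenerate) interval `I`, parametrised by arclength. -/
structure IsArclengthCurve (g : SmoothRiemannianMetric n M) (γ : ℝ → M) (I : Set ℝ) : Prop where
  ordConnected : I.OrdConnected
  nontrivial : I.Nontrivial
  smooth : ContMDiffOn 𝓘(ℝ, ℝ) (𝓡 n) ∞ γ I
  unit_speed : ∀ s ∈ I, g.inner (γ s) (velocity γ I s) (velocity γ I s) = 1

/-- The components of `γ'(s)` in the chart `φ`. -/
def coordVelocity (φ : OpenPartialHomeomorph M (EuclideanSpace ℝ (Fin n))) (γ : ℝ → M)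
    (I : Set ℝ) (s : ℝ) : Fin n → ℝ :=
  fun i => derivWithin (fun t => φ (γ t) i) I s

/-- The components in the chart `φ` of the covariant derivative `∇_{γ'} V` of a vector field along
`γ` with components `V`: `(∇_{γ'} V)ᵏ = (Vᵏ)' + ∑ᵢⱼ Γᵏᵢⱼ (γⁱ)' Vʲ`. -/
def covDerivAlong (g : SmoothRiemannianMetric n M)
    (φ : OpenPartialHomeomorph M (EuclideanSpace ℝ (Fin n))) (γ : ℝ → M) (I : Set ℝ)
    (V : ℝ → Fin n → ℝ) (s : ℝ) : Fin n → ℝ :=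
  fun k => derivWithin (fun t => V t k) I s
    + ∑ i, ∑ j, christoffel g φ k i j (φ (γ s)) * coordVelocity φ γ I s i * V s j

/-- The components in the chart `φ` of the tension field `τ(γ) = ∇_{γ'} γ'`. -/
def coordTension (g : SmoothRiemannianMetric n M)
    (φ : OpenPartialHomeomorph M (EuclideanSpace ℝ (Fin n))) (γ : ℝ → M) (I : Set ℝ) :
    ℝ → Fin n → ℝ :=
  covDerivAlong g φ γ I (coordVelocity φ γ I)

/-- `γ` is a `p`-biharmonic curve without geodesic points: `τ = ∇_{γ'} γ'` vanishes nowhere and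
`∇_{γ'} ∇_{γ'} (|τ|^(p-2) τ) - |τ|^(p-2) R(γ', τ) γ' = 0`, the Euler-Lagrange equation of the
energy `(1/p) ∫ |τ|^p`. The equation is written in every chart of `M`. -/
def IsPBiharmonicCurve (p : ℝ) (g : SmoothRiemannianMetric n M) (γ : ℝ → M) (I : Set ℝ) : Prop :=
  ∀ φ ∈ IsManifold.maximalAtlas (𝓡 n) ∞ M, ∀ s ∈ I, γ s ∈ φ.source →
    coordTension g φ γ I s ≠ 0 ∧
    covDerivAlong g φ γ I
        (covDerivAlong g φ γ I
          (fun t => coordNorm g φ (φ (γ t)) (coordTension g φ γ I t) ^ (p - 2) •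
            coordTension g φ γ I t)) s
      - coordNorm g φ (φ (γ s)) (coordTension g φ γ I s) ^ (p - 2) •
          riemannApply g φ (φ (γ s)) (coordVelocity φ γ I s) (coordTension g φ γ I s)
            (coordVelocity φ γ I s) = 0

end Charts

section Surfaces

variable {M : Type u} [TopologicalSpace M] [ChartedSpace (EuclideanSpace ℝ (Fin 2)) M]
  [IsManifold (𝓡 2) ∞ M]

/-- The Gauss curvature `⟨R(∂₁, ∂₂) ∂₂, ∂₁⟩ / det (gᵢⱼ)` of the surface is constant, equal
to `K`. -/
def HasConstantGaussCurvature (g : SmoothRiemannianMetric 2 M) (K : ℝ) : Prop :=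
  ∀ φ ∈ IsManifold.maximalAtlas (𝓡 2) ∞ M, ∀ y ∈ φ.target,
    (∑ l, metricCoeff g φ y 0 l * riemannCoeff g φ l 0 1 1 y) / (metricCoeff g φ y).det = K

/-- `k` is the geodesic curvature of the arclength curve `γ` on the surface `M` with respect to
some choice of a smooth unit normal field `N` along `γ`: with `T = γ'` one has `∇_T T = k N`
(written in every chart). -/
def IsGeodesicCurvature (g : SmoothRiemannianMetric 2 M) (γ : ℝ → M) (I : Set ℝ) (k : ℝ → ℝ) :
    Prop :=
  ∃ N : (s : ℝ) → TangentSpace (𝓡 2) (γ s),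
    ContMDiffOn 𝓘(ℝ, ℝ) (𝓡 2).tangent ∞
      (fun s => (⟨γ s, N s⟩ : TangentBundle (𝓡 2) M)) I ∧
    (∀ s ∈ I, g.inner (γ s) (N s) (N s) = 1) ∧
    (∀ s ∈ I, g.inner (γ s) (velocity γ I s) (N s) = 0) ∧
    ∀ φ ∈ IsManifold.maximalAtlas (𝓡 2) ∞ M, ∀ s ∈ I, γ s ∈ φ.source → ∀ i : Fin 2,
      coordTension g φ γ I s i =
        k s * (show EuclideanSpace ℝ (Fin 2) from mfderiv (𝓡 2) (𝓡 2) φ (γ s) (N s)) i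

/-- `γ` is a proper `½`-biharmonic curve: a `½`-biharmonic curve of non-constant geodesic
curvature. -/
def IsProperHalfBiharmonicCurve (g : SmoothRiemannianMetric 2 M) (γ : ℝ → M) (I : Set ℝ) : Prop :=
  IsPBiharmonicCurve (1 / 2) g γ I ∧
    ∃ k : ℝ → ℝ, IsGeodesicCurvature g γ I k ∧ ∃ s ∈ I, ∃ t ∈ I, k s ≠ k t

end Surfaces

/-- `k` solves the curvature equation `¾ k'² - ½ k k'' - k⁴ + K k² = 0`. -/
def SolvesCurvatureODE (K : ℝ) (k : ℝ → ℝ) : Prop :=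
  ContDiff ℝ ∞ k ∧ ∀ s : ℝ,
    3 / 4 * deriv k s ^ 2 - 1 / 2 * k s * deriv (deriv k) s - k s ^ 4 + K * k s ^ 2 = 0

end

/-! Let T be the unit tangent and τ = kN. If k > 0, then |τ|^(-3/2) τ = rN with r = k^(-1/2). The
Frenet equations ∇_T T = kN and ∇_T N = -kT give ∇_T ∇_T (rN) = (r'' - rk²) N - (2r'k + rk') T. On a
surface of curvature K, R(T, N)T = -KN. The Euler–Lagrange equation therefore splits into a
tangential part 2r'k + rk' = 0, which is the derivative of r²k = 1 divided by r, and a normal part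
r'' - rk² + Kr = 0, which is r/k² times the curvature equation. This is
`SolvesCurvatureODE.rpow_neg_half` together with `IsArclengthCurve.halfBiharmonic_equation`. A
negative k is reduced to a positive one by changing the sign of N.

For k = a/D the curvature equation becomes ½DD'' - ¼D'² + KD² = a². The three families are the cases
where D is a quadratic polynomial, a constant plus a sine, and a constant plus two exponentials
(`solvesCurvatureODE_const_div`). A constant solution satisfies k⁴ = Kk²; this excludes constancy
for K ≤ 0, and the sphere needs one further computation.

Everything is computed in an arbitrary chart, so the basic facts on the Levi-Civita connection are
derived from the Christoffel formula: metric compatibility, skew-adjointness of the curvature, and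
R(T, Y)T = -KY for Y orthogonal to the unit vector T. The curvatures 0 and 1 of the plane and the
sphere come from the Gauss equation of a local isometric parametrisation X into Euclidean space. -/

noncomputable section

/-! ### The metric in a chart -/

section ChartRegularity

variable {n : ℕ} {M : Type u} [TopologicalSpace M] [ChartedSpace (EuclideanSpace ℝ (Fin n)) M]
  {φ : OpenPartialHomeomorph M (EuclideanSpace ℝ (Fin n))}

theorem mdifferentiable_of_mem_maximalAtlas (hφ : φ ∈ IsManifold.maximalAtlas (𝓡 n) ∞ M) :
    φ.MDifferentiable (𝓡 n) (𝓡 n) :=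
  ⟨fun _ hx => ((contMDiffAt_of_mem_maximalAtlas hφ hx).mdifferentiableAt
      (by simp)).mdifferentiableWithinAt,
    fun _ hx => ((contMDiffAt_symm_of_mem_maximalAtlas hφ hx).mdifferentiableAt
      (by simp)).mdifferentiableWithinAt⟩

variable [IsManifold (𝓡 n) ∞ M]

/-- The field is the image of a constant section under the tangent map of the inverse chart;
evaluating g on such fields gives smooth coefficients. -/
theorem contMDiffOn_coordField (hφ : φ ∈ IsManifold.maximalAtlas (𝓡 n) ∞ M) (i : Fin n) :
    ContMDiffOn (𝓡 n) (𝓡 n).tangent ∞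
      (fun y => (⟨φ.symm y, coordField φ y i⟩ : TangentBundle (𝓡 n) M)) φ.target := by
  have h1 := (contMDiffOn_symm_of_mem_maximalAtlas hφ).contMDiffOn_tangentMapWithin (m := ∞)
    (by simp) φ.open_target.uniqueMDiffOn
  have h2 : ContMDiff (𝓡 n) (𝓡 n).tangent ∞
      (fun y : EuclideanSpace ℝ (Fin n) =>
        (⟨y, (EuclideanSpace.single i (1 : ℝ) : EuclideanSpace ℝ (Fin n))⟩ :
          TangentBundle (𝓡 n) (EuclideanSpace ℝ (Fin n)))) :=
    fun y => contMDiffAt_vectorSpace_iff_contDiffAt.2 contDiffAt_const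
  refine (h1.comp (t := _) h2.contMDiffOn (s := φ.target) fun y hy => hy).congr fun y hy => ?_
  simp [tangentMapWithin, coordField, mfderivWithin_of_mem_nhds (φ.open_target.mem_nhds hy)]

theorem contDiffOn_metricCoeff (g : SmoothRiemannianMetric n M)
    (hφ : φ ∈ IsManifold.maximalAtlas (𝓡 n) ∞ M) (i j : Fin n) :
    ContDiffOn ℝ ∞ (fun y => metricCoeff g φ y i j) φ.target := by
  rw [← contMDiffOn_iff_contDiffOn]
  intro y hy
  have : ContMDiffWithinAt (𝓡 n) ((𝓡 n).prod 𝓘(ℝ)) ∞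
      (fun y ↦ Bundle.TotalSpace.mk' ℝ (E := Bundle.Trivial M ℝ) (φ.symm y)
        (g.inner (φ.symm y) (coordField φ y i) (coordField φ y j))) φ.target y := by
    apply ContMDiffWithinAt.clm_bundle_apply₂ (F₁ := EuclideanSpace ℝ (Fin n))
      (F₂ := EuclideanSpace ℝ (Fin n))
    · exact ContMDiffAt.comp_contMDiffWithinAt y g.contMDiff.contMDiffAt
        (contMDiffOn_symm_of_mem_maximalAtlas hφ y hy)
    · exact contMDiffOn_coordField hφ i y hy
    · exact contMDiffOn_coordField hφ j y hy
  simp only [Bundle.contMDiffWithinAt_totalSpace] at this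
  exact this.2

theorem metricCoeff_symm (g : SmoothRiemannianMetric n M) (y : EuclideanSpace ℝ (Fin n))
    (i j : Fin n) : metricCoeff g φ y i j = metricCoeff g φ y j i :=
  g.symm _ _ _

/-- In coordinates, `g` is given by its coefficients. -/
theorem inner_mfderiv_symm (g : SmoothRiemannianMetric n M) (y v w : EuclideanSpace ℝ (Fin n)) :
    g.inner (φ.symm y) (mfderiv (𝓡 n) (𝓡 n) φ.symm y v) (mfderiv (𝓡 n) (𝓡 n) φ.symm y w) =
      ∑ i, ∑ j, metricCoeff g φ y i j * v i * w j := by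
  have key : ∀ v : EuclideanSpace ℝ (Fin n), mfderiv (𝓡 n) (𝓡 n) φ.symm y v =
      ∑ i, v i • coordField φ y i := by
    intro v
    have h : v = ∑ i, v i • EuclideanSpace.single i (1 : ℝ) := by
      ext j; simp [Finset.sum_apply, Pi.single_apply]
    conv_lhs => rw [h]
    exact (map_sum _ _ _).trans (Finset.sum_congr rfl fun i _ => map_smul _ _ _)
  rw [key, key]
  simp only [map_sum, sum_apply, map_smul, smul_apply,
    smul_eq_mul, metricCoeff, Matrix.of_apply]
  simp only [Finset.mul_sum]
  rw [Finset.sum_comm]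
  refine Finset.sum_congr rfl fun i _ => Finset.sum_congr rfl fun j _ => ?_
  ring

theorem inner_eq_sum_metricCoeff (g : SmoothRiemannianMetric n M)
    (hφ : φ ∈ IsManifold.maximalAtlas (𝓡 n) ∞ M) {x : M} (hx : x ∈ φ.source)
    (v w : TangentSpace (𝓡 n) x) :
    g.inner x v w = ∑ i, ∑ j, metricCoeff g φ (φ x) i j *
      (show EuclideanSpace ℝ (Fin n) from mfderiv (𝓡 n) (𝓡 n) φ x v) i *
      (show EuclideanSpace ℝ (Fin n) from mfderiv (𝓡 n) (𝓡 n) φ x w) j := by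
  have h := (mdifferentiable_of_mem_maximalAtlas hφ).symm_comp_deriv hx
  have h1 : ∀ v : TangentSpace (𝓡 n) x,
      mfderiv (𝓡 n) (𝓡 n) φ.symm (φ x) (mfderiv (𝓡 n) (𝓡 n) φ x v) = v :=
    fun v => congrArg (fun L => L v) h
  have h2 := inner_mfderiv_symm (φ := φ) g (φ x) (mfderiv (𝓡 n) (𝓡 n) φ x v)
    (mfderiv (𝓡 n) (𝓡 n) φ x w)
  refine Eq.trans ?_ h2
  rw [h1, h1, φ.left_inv hx]

theorem metricCoeff_pos (g : SmoothRiemannianMetric n M)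
    (hφ : φ ∈ IsManifold.maximalAtlas (𝓡 n) ∞ M) {y : EuclideanSpace ℝ (Fin n)}
    (hy : y ∈ φ.target) {v : EuclideanSpace ℝ (Fin n)} (hv : v ≠ 0) :
    0 < ∑ i, ∑ j, metricCoeff g φ y i j * v i * v j := by
  rw [← inner_mfderiv_symm (φ := φ) g y v v]
  refine g.pos _ _ fun h => hv ?_
  have h1 := (mdifferentiable_of_mem_maximalAtlas hφ).comp_symm_deriv hy
  have h2 : mfderiv (𝓡 n) (𝓡 n) φ (φ.symm y) (mfderiv (𝓡 n) (𝓡 n) φ.symm y v) = v :=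
    congrArg (fun L => L v) h1
  rw [h, map_zero] at h2
  exact h2.symm

end ChartRegularity

/-! ### Smoothness of the inverse metric and of the Christoffel symbols -/

section SurfaceCharts

variable {M : Type u} [TopologicalSpace M] [ChartedSpace (EuclideanSpace ℝ (Fin 2)) M]
  [IsManifold (𝓡 2) ∞ M]
  {φ : OpenPartialHomeomorph M (EuclideanSpace ℝ (Fin 2))}

theorem metricCoeff_det_pos (g : SmoothRiemannianMetric 2 M)
    (hφ : φ ∈ IsManifold.maximalAtlas (𝓡 2) ∞ M) {y : EuclideanSpace ℝ (Fin 2)}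
    (hy : y ∈ φ.target) : 0 < (metricCoeff g φ y).det := by
  have h0 : 0 < metricCoeff g φ y 0 0 := by
    have := metricCoeff_pos g hφ hy (v := !₂[1, 0]) (by
      intro h; simpa using congrArg (fun v : EuclideanSpace ℝ (Fin 2) => v 0) h)
    simpa [Fin.sum_univ_two] using this
  -- The quadratic form takes the value g₀₀ · det g at the vector (-g₀₁, g₀₀).
  have h1 := metricCoeff_pos g hφ hy
    (v := !₂[-metricCoeff g φ y 0 1, metricCoeff g φ y 0 0]) (by
      intro h; exact h0.ne' (by simpa using congrArg (fun v : EuclideanSpace ℝ (Fin 2) => v 1) h))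
  rw [Matrix.det_fin_two]
  simp only [Fin.sum_univ_two] at h1
  simp [metricCoeff_symm g y 1 0] at h1 ⊢
  by_contra h
  nlinarith

/-- The inverse metric is smooth. -/
theorem contDiffOn_metricCoeff_inv (g : SmoothRiemannianMetric 2 M)
    (hφ : φ ∈ IsManifold.maximalAtlas (𝓡 2) ∞ M) (i j : Fin 2) :
    ContDiffOn ℝ ∞ (fun y => (metricCoeff g φ y)⁻¹ i j) φ.target := by
  have hG := contDiffOn_metricCoeff g hφ
  have hd : ContDiffOn ℝ ∞ (fun y => (metricCoeff g φ y).det) φ.target := by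
    simp only [Matrix.det_fin_two]
    exact ((hG 0 0).mul (hG 1 1)).sub ((hG 0 1).mul (hG 1 0))
  have hdi := hd.inv fun y hy => (metricCoeff_det_pos g hφ hy).ne'
  simp only [Matrix.inv_def, Matrix.adjugate_fin_two, Ring.inverse_eq_inv', Matrix.smul_apply,
    smul_eq_mul]
  fin_cases i <;> fin_cases j <;> simp
  · exact hdi.mul (hG 1 1)
  · exact (hdi.mul (hG 0 1)).neg
  · exact (hdi.mul (hG 1 0)).neg
  · exact hdi.mul (hG 0 0)

theorem ContDiffOn.partialDeriv {f : EuclideanSpace ℝ (Fin 2) → ℝ}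
    {U : Set (EuclideanSpace ℝ (Fin 2))} (hf : ContDiffOn ℝ ∞ f U) (hU : IsOpen U) (i : Fin 2) :
    ContDiffOn ℝ ∞ (partialDeriv i f) U :=
  (hf.fderiv_of_isOpen hU (m := ∞) (by simp)).clm_apply contDiffOn_const

theorem contDiffOn_christoffel (g : SmoothRiemannianMetric 2 M)
    (hφ : φ ∈ IsManifold.maximalAtlas (𝓡 2) ∞ M) (k i j : Fin 2) :
    ContDiffOn ℝ ∞ (christoffel g φ k i j) φ.target := by
  have hG := fun i j l => (contDiffOn_metricCoeff g hφ i j).partialDeriv φ.open_target l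
  unfold christoffel
  refine contDiffOn_const.mul (ContDiffOn.sum fun l _ => ?_)
  exact (contDiffOn_metricCoeff_inv g hφ k l).mul (((hG _ _ _).add (hG _ _ _)).sub (hG _ _ _))

end SurfaceCharts

/-! ### Calculus of partial derivatives -/

section PartialDerivatives

variable {f h : EuclideanSpace ℝ (Fin 2) → ℝ} {y : EuclideanSpace ℝ (Fin 2)}

theorem fderiv_apply_eq_sum_partialDeriv (f : EuclideanSpace ℝ (Fin 2) → ℝ)
    (y v : EuclideanSpace ℝ (Fin 2)) : fderiv ℝ f y v = ∑ i, v i * partialDeriv i f y := by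
  have h : v = ∑ i, v i • EuclideanSpace.single i (1 : ℝ) := by
    ext j; fin_cases j <;> simp
  conv_lhs => rw [h]
  simp [partialDeriv]

theorem partialDeriv_add (i : Fin 2) (hf : DifferentiableAt ℝ f y) (hh : DifferentiableAt ℝ h y) :
    partialDeriv i (fun z => f z + h z) y = partialDeriv i f y + partialDeriv i h y := by
  simp [partialDeriv, fderiv_fun_add hf hh]

theorem partialDeriv_mul (i : Fin 2) (hf : DifferentiableAt ℝ f y) (hh : DifferentiableAt ℝ h y) :
    partialDeriv i (fun z => f z * h z) y
      = partialDeriv i f y * h y + f y * partialDeriv i h y := by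
  simp only [partialDeriv, fderiv_fun_mul hf hh]
  simp
  ring

theorem partialDeriv_congr (i : Fin 2) (hfh : f =ᶠ[nhds y] h) :
    partialDeriv i f y = partialDeriv i h y := by
  rw [partialDeriv, partialDeriv, hfh.fderiv_eq]

theorem ContDiffAt.partialDeriv_comm (hf : ContDiffAt ℝ ∞ f y) (i j : Fin 2) :
    partialDeriv i (partialDeriv j f) y = partialDeriv j (partialDeriv i f) y := by
  have hd : DifferentiableAt ℝ (fderiv ℝ f) y :=
    (hf.fderiv_right (m := 1) (by norm_cast)).differentiableAt (by simp)
  have key : ∀ i j : Fin 2, partialDeriv i (partialDeriv j f) y =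
      fderiv ℝ (fderiv ℝ f) y (EuclideanSpace.single i 1) (EuclideanSpace.single j 1) := by
    intro i j
    have : partialDeriv j f = fun z => fderiv ℝ f z (EuclideanSpace.single j 1) := rfl
    rw [partialDeriv, this, fderiv_clm_apply hd (differentiableAt_const _)]
    simp
  rw [key, key]
  exact (hf.isSymmSndFDerivAt (by simpa using ENat.LEInfty.out)).eq _ _

end PartialDerivatives

/-! ### Metric compatibility and symmetry of the curvature tensor -/

section Connection

variable {M : Type u} [TopologicalSpace M] [ChartedSpace (EuclideanSpace ℝ (Fin 2)) M]
  [IsManifold (𝓡 2) ∞ M]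
  {φ : OpenPartialHomeomorph M (EuclideanSpace ℝ (Fin 2))} (g : SmoothRiemannianMetric 2 M)
  {y : EuclideanSpace ℝ (Fin 2)}

theorem partialDeriv_metricCoeff_symm (i j k : Fin 2) (y : EuclideanSpace ℝ (Fin 2)) :
    partialDeriv k (fun z => metricCoeff g φ z i j) y =
      partialDeriv k (fun z => metricCoeff g φ z j i) y := by
  simp only [metricCoeff_symm g _ i j]

/-- The Christoffel symbols of the first kind. -/
theorem sum_metricCoeff_mul_christoffel (hφ : φ ∈ IsManifold.maximalAtlas (𝓡 2) ∞ M)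
    (hy : y ∈ φ.target) (a i j : Fin 2) :
    ∑ l, metricCoeff g φ y a l * christoffel g φ l i j y =
      1 / 2 * (partialDeriv i (fun z => metricCoeff g φ z j a) y
        + partialDeriv j (fun z => metricCoeff g φ z i a) y
        - partialDeriv a (fun z => metricCoeff g φ z i j) y) := by
  have h : metricCoeff g φ y * (metricCoeff g φ y)⁻¹ = 1 :=
    Matrix.mul_nonsing_inv _ (metricCoeff_det_pos g hφ hy).ne'.isUnit
  have h' : ∀ b, ∑ l, metricCoeff g φ y a l * (metricCoeff g φ y)⁻¹ l b = if a = b then 1 else 0 :=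
    fun b => by rw [← Matrix.mul_apply, h, Matrix.one_apply]
  have h0 := h' 0
  have h1 := h' 1
  simp only [christoffel, Fin.sum_univ_two] at h0 h1 ⊢
  fin_cases a <;> simp at h0 h1 ⊢
  · linear_combination (1 / 2 * (partialDeriv i (fun z => metricCoeff g φ z j 0) y
        + partialDeriv j (fun z => metricCoeff g φ z i 0) y
        - partialDeriv 0 (fun z => metricCoeff g φ z i j) y)) * h0 +
      (1 / 2 * (partialDeriv i (fun z => metricCoeff g φ z j 1) y
        + partialDeriv j (fun z => metricCoeff g φ z i 1) y
        - partialDeriv 1 (fun z => metricCoeff g φ z i j) y)) * h1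
  · linear_combination (1 / 2 * (partialDeriv i (fun z => metricCoeff g φ z j 0) y
        + partialDeriv j (fun z => metricCoeff g φ z i 0) y
        - partialDeriv 0 (fun z => metricCoeff g φ z i j) y)) * h0 +
      (1 / 2 * (partialDeriv i (fun z => metricCoeff g φ z j 1) y
        + partialDeriv j (fun z => metricCoeff g φ z i 1) y
        - partialDeriv 1 (fun z => metricCoeff g φ z i j) y)) * h1

/-- The Levi-Civita connection is compatible with the metric. -/
theorem partialDeriv_metricCoeff (hφ : φ ∈ IsManifold.maximalAtlas (𝓡 2) ∞ M)
    (hy : y ∈ φ.target) (m i j : Fin 2) :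
    partialDeriv m (fun z => metricCoeff g φ z i j) y =
      ∑ l, metricCoeff g φ y i l * christoffel g φ l m j y +
        ∑ l, metricCoeff g φ y j l * christoffel g φ l m i y := by
  rw [sum_metricCoeff_mul_christoffel g hφ hy, sum_metricCoeff_mul_christoffel g hφ hy,
    partialDeriv_metricCoeff_symm g j i m]
  ring

/-- The tensor `R(∂₀, ∂₁)` is skew-adjoint. -/
theorem metricCoeff_mul_riemannCoeff_skew (hφ : φ ∈ IsManifold.maximalAtlas (𝓡 2) ∞ M)
    (hy : y ∈ φ.target) (a b : Fin 2) :
    ∑ l, metricCoeff g φ y a l * riemannCoeff g φ l 0 1 b y +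
      ∑ l, metricCoeff g φ y b l * riemannCoeff g φ l 0 1 a y = 0 := by
  have hU := φ.open_target.mem_nhds hy
  have hG : ∀ i j, DifferentiableAt ℝ (fun z => metricCoeff g φ z i j) y := fun i j =>
    ((contDiffOn_metricCoeff g hφ i j).contDiffAt hU).differentiableAt (by simp)
  have hΓ : ∀ k i j, DifferentiableAt ℝ (fun z => christoffel g φ k i j z) y := fun k i j =>
    ((contDiffOn_christoffel g hφ k i j).contDiffAt hU).differentiableAt (by simp)
  have h2 : ∀ i m, partialDeriv i (partialDeriv m (fun z => metricCoeff g φ z a b)) y =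
      ∑ l, (partialDeriv i (fun z => metricCoeff g φ z a l) y * christoffel g φ l m b y +
        metricCoeff g φ y a l * partialDeriv i (fun z => christoffel g φ l m b z) y) +
      ∑ l, (partialDeriv i (fun z => metricCoeff g φ z b l) y * christoffel g φ l m a y +
        metricCoeff g φ y b l * partialDeriv i (fun z => christoffel g φ l m a z) y) := by
    intro i m
    have : partialDeriv m (fun z => metricCoeff g φ z a b) =ᶠ[nhds y] fun z =>
        (metricCoeff g φ z a 0 * christoffel g φ 0 m b z +
          metricCoeff g φ z a 1 * christoffel g φ 1 m b z) +
        (metricCoeff g φ z b 0 * christoffel g φ 0 m a z +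
          metricCoeff g φ z b 1 * christoffel g φ 1 m a z) := by
      filter_upwards [hU] with z hz
      rw [partialDeriv_metricCoeff g hφ hz, Fin.sum_univ_two, Fin.sum_univ_two]
    rw [partialDeriv_congr i this]
    have hp : ∀ a l b, DifferentiableAt ℝ
        (fun z => metricCoeff g φ z a l * christoffel g φ l m b z) y := fun a l b =>
      (hG a l).mul (hΓ l m b)
    rw [partialDeriv_add i ((hp a 0 b).fun_add (hp a 1 b)) ((hp b 0 a).fun_add (hp b 1 a)),
      partialDeriv_add i (hp a 0 b) (hp a 1 b), partialDeriv_add i (hp b 0 a) (hp b 1 a)]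
    simp only [partialDeriv_mul i (hG _ _) (hΓ _ _ _), Fin.sum_univ_two]
  -- The second derivatives of g_ab commute. Once the first derivatives of g are expressed through
  -- Γ, the terms pairing a Γ with lower index a and a Γ with lower index b are symmetric in the two
  -- directions and cancel; the curvature components remain.
  have hc := ((contDiffOn_metricCoeff g hφ a b).contDiffAt hU).partialDeriv_comm 0 1
  rw [h2, h2] at hc
  simp only [partialDeriv_metricCoeff g hφ hy] at hc
  simp only [riemannCoeff]
  simp only [Fin.sum_univ_two, metricCoeff_symm g y 1 0] at hc ⊢
  linear_combination hc

end Connection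

/-! ### Covariant differentiation along a curve -/

theorem uniqueDiffOn_of_ordConnected_of_nontrivial {I : Set ℝ} (hI : I.OrdConnected)
    (hI' : I.Nontrivial) : UniqueDiffOn ℝ I := by
  obtain ⟨a, ha, b, hb, hab⟩ := hI'.exists_lt
  refine uniqueDiffOn_convex hI.convex ⟨(a + b) / 2, ?_⟩
  refine interior_mono (hI.out ha hb) ?_
  rw [interior_Icc]
  constructor <;> linarith

theorem ContDiffWithinAt.contDiffWithinAt_derivWithin {f : ℝ → ℝ} {I : Set ℝ} {s : ℝ}
    (hf : ContDiffWithinAt ℝ ∞ f I s) (hI : UniqueDiffOn ℝ I) (hs : s ∈ I) :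
    ContDiffWithinAt ℝ ∞ (derivWithin f I) I s :=
  (hf.fderivWithin_right (m := ∞) hI (by simp) hs).clm_apply contDiffWithinAt_const

section Curves

variable {M : Type u} [TopologicalSpace M] [ChartedSpace (EuclideanSpace ℝ (Fin 2)) M]
  [IsManifold (𝓡 2) ∞ M]
  {φ : OpenPartialHomeomorph M (EuclideanSpace ℝ (Fin 2))} {g : SmoothRiemannianMetric 2 M}
  {γ : ℝ → M} {I : Set ℝ} {s : ℝ}

/-- The inner product of the vectors with components `V` and `W`. -/
def coordInner (g : SmoothRiemannianMetric 2 M)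
    (φ : OpenPartialHomeomorph M (EuclideanSpace ℝ (Fin 2))) (y : EuclideanSpace ℝ (Fin 2))
    (V W : Fin 2 → ℝ) : ℝ :=
  ∑ i, ∑ j, metricCoeff g φ y i j * V i * W j

theorem IsArclengthCurve.uniqueDiffOn (hγ : IsArclengthCurve g γ I) : UniqueDiffOn ℝ I :=
  uniqueDiffOn_of_ordConnected_of_nontrivial hγ.ordConnected hγ.nontrivial

theorem IsArclengthCurve.eventually_mem_source (hγ : IsArclengthCurve g γ I) (hs : s ∈ I)
    (hγs : γ s ∈ φ.source) : ∀ᶠ t in nhdsWithin s I, t ∈ I ∧ γ t ∈ φ.source :=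
  eventually_mem_nhdsWithin.and
    ((hγ.smooth s hs).continuousWithinAt (φ.open_source.mem_nhds hγs))

theorem IsArclengthCurve.contDiffWithinAt_chart (hγ : IsArclengthCurve g γ I)
    (hφ : φ ∈ IsManifold.maximalAtlas (𝓡 2) ∞ M) (hs : s ∈ I) (hγs : γ s ∈ φ.source) :
    ContDiffWithinAt ℝ ∞ (fun t => φ (γ t)) I s := by
  rw [← contMDiffWithinAt_iff_contDiffWithinAt]
  exact (contMDiffAt_of_mem_maximalAtlas hφ hγs).comp_contMDiffWithinAt s (hγ.smooth s hs)

theorem IsArclengthCurve.contDiffWithinAt_coord (hγ : IsArclengthCurve g γ I)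
    (hφ : φ ∈ IsManifold.maximalAtlas (𝓡 2) ∞ M) (hs : s ∈ I) (hγs : γ s ∈ φ.source)
    (i : Fin 2) : ContDiffWithinAt ℝ ∞ (fun t => φ (γ t) i) I s :=
  contDiffWithinAt_euclidean.1 (hγ.contDiffWithinAt_chart hφ hs hγs) i

theorem IsArclengthCurve.contDiffWithinAt_coordVelocity (hγ : IsArclengthCurve g γ I)
    (hφ : φ ∈ IsManifold.maximalAtlas (𝓡 2) ∞ M) (hs : s ∈ I) (hγs : γ s ∈ φ.source)
    (i : Fin 2) : ContDiffWithinAt ℝ ∞ (fun t => coordVelocity φ γ I t i) I s :=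
  (hγ.contDiffWithinAt_coord hφ hs hγs i).contDiffWithinAt_derivWithin hγ.uniqueDiffOn hs

theorem IsArclengthCurve.contDiffWithinAt_covDerivAlong (hγ : IsArclengthCurve g γ I)
    (hφ : φ ∈ IsManifold.maximalAtlas (𝓡 2) ∞ M) (hs : s ∈ I) (hγs : γ s ∈ φ.source)
    {V : ℝ → Fin 2 → ℝ} (hV : ∀ i, ContDiffWithinAt ℝ ∞ (fun t => V t i) I s) (k : Fin 2) :
    ContDiffWithinAt ℝ ∞ (fun t => covDerivAlong g φ γ I V t k) I s := by
  unfold covDerivAlong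
  refine ((hV k).contDiffWithinAt_derivWithin hγ.uniqueDiffOn hs).add
    (ContDiffWithinAt.sum fun i _ => ContDiffWithinAt.sum fun j _ => ?_)
  refine (ContDiffWithinAt.mul ?_ (hγ.contDiffWithinAt_coordVelocity hφ hs hγs i)).mul (hV j)
  have h : ContDiffWithinAt ℝ ∞ (christoffel g φ k i j ∘ fun t => φ (γ t)) I s :=
    ((contDiffOn_christoffel g hφ k i j).contDiffAt
      (φ.open_target.mem_nhds (φ.map_source hγs))).comp_contDiffWithinAt s
        (hγ.contDiffWithinAt_chart hφ hs hγs)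
  exact h

theorem IsArclengthCurve.hasDerivWithinAt_chart (hγ : IsArclengthCurve g γ I)
    (hφ : φ ∈ IsManifold.maximalAtlas (𝓡 2) ∞ M) (hs : s ∈ I) (hγs : γ s ∈ φ.source) :
    HasDerivWithinAt (fun t => φ (γ t)) (WithLp.toLp 2 (coordVelocity φ γ I s)) I s := by
  have h := ((hγ.contDiffWithinAt_chart hφ hs hγs).differentiableWithinAt
    (by simp)).hasDerivWithinAt
  have e : WithLp.toLp 2 (coordVelocity φ γ I s) = derivWithin (fun t => φ (γ t)) I s := by
    ext i
    exact (((EuclideanSpace.proj i : EuclideanSpace ℝ (Fin 2) →L[ℝ] ℝ).hasFDerivAt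
    (x := φ (γ s))).comp_hasDerivWithinAt s h).derivWithin
      (hγ.uniqueDiffOn s hs)
  rw [e]
  exact h

/-- Chain rule. It transfers the intrinsic conditions on the velocity, unit length and orthogonality
to N, to components. -/
theorem IsArclengthCurve.coordVelocity_eq (hγ : IsArclengthCurve g γ I)
    (hφ : φ ∈ IsManifold.maximalAtlas (𝓡 2) ∞ M) (hs : s ∈ I) (hγs : γ s ∈ φ.source) :
    WithLp.toLp 2 (coordVelocity φ γ I s) =
      (show EuclideanSpace ℝ (Fin 2) from
        mfderiv (𝓡 2) (𝓡 2) φ (γ s) (velocity γ I s)) := by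
  have h1 : HasMFDerivWithinAt 𝓘(ℝ, ℝ) (𝓡 2) (φ ∘ γ) I s _ :=
    ((contMDiffAt_of_mem_maximalAtlas hφ hγs).mdifferentiableAt
      (by simp)).hasMFDerivAt.comp_hasMFDerivWithinAt s
      ((hγ.smooth s hs).mdifferentiableWithinAt (by simp)).hasMFDerivWithinAt
  have h2 : HasFDerivWithinAt (φ ∘ γ) (_ : ℝ →L[ℝ] EuclideanSpace ℝ (Fin 2)) I s :=
    hasMFDerivWithinAt_iff_hasFDerivWithinAt.1 h1
  have h3 := (hγ.hasDerivWithinAt_chart hφ hs hγs).derivWithin (hγ.uniqueDiffOn s hs)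
  exact h3.symm.trans (h2.hasDerivWithinAt.derivWithin (hγ.uniqueDiffOn s hs))

theorem IsArclengthCurve.coordInner_coordVelocity (hγ : IsArclengthCurve g γ I)
    (hφ : φ ∈ IsManifold.maximalAtlas (𝓡 2) ∞ M) (hs : s ∈ I) (hγs : γ s ∈ φ.source) :
    coordInner g φ (φ (γ s)) (coordVelocity φ γ I s) (coordVelocity φ γ I s) = 1 := by
  rw [← hγ.unit_speed s hs, inner_eq_sum_metricCoeff g hφ hγs, ← hγ.coordVelocity_eq hφ hs hγs]
  rfl

/-- Formulas for τ and N in a chart hold only while γ stays in its source, hence only as germs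
within I. -/
theorem covDerivAlong_congr {V W : ℝ → Fin 2 → ℝ} (h : V =ᶠ[nhdsWithin s I] W) (hs : s ∈ I) :
    covDerivAlong g φ γ I V s = covDerivAlong g φ γ I W s := by
  have h0 := h.self_of_nhdsWithin hs
  ext k
  have : (fun t => V t k) =ᶠ[nhdsWithin s I] fun t => W t k := h.fun_comp (· k)
  simp only [covDerivAlong, this.derivWithin_eq (congrFun h0 k), h0]

theorem covDerivAlong_add {V W : ℝ → Fin 2 → ℝ}
    (hV : ∀ i, DifferentiableWithinAt ℝ (fun t => V t i) I s)
    (hW : ∀ i, DifferentiableWithinAt ℝ (fun t => W t i) I s) :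
    covDerivAlong g φ γ I (fun t => V t + W t) s =
      covDerivAlong g φ γ I V s + covDerivAlong g φ γ I W s := by
  ext k
  simp only [covDerivAlong, Pi.add_apply, derivWithin_fun_add (hV k) (hW k), Fin.sum_univ_two]
  ring

theorem covDerivAlong_smul {f : ℝ → ℝ} {V : ℝ → Fin 2 → ℝ}
    (hf : DifferentiableWithinAt ℝ f I s)
    (hV : ∀ i, DifferentiableWithinAt ℝ (fun t => V t i) I s) :
    covDerivAlong g φ γ I (fun t => f t • V t) s =
      derivWithin f I s • V s + f s • covDerivAlong g φ γ I V s := by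
  ext k
  simp only [covDerivAlong, Pi.add_apply, Pi.smul_apply, smul_eq_mul,
    derivWithin_fun_mul hf (hV k), Fin.sum_univ_two]
  ring

/-- The Levi-Civita connection along a curve is compatible with the metric. -/
theorem IsArclengthCurve.hasDerivWithinAt_coordInner (hγ : IsArclengthCurve g γ I)
    (hφ : φ ∈ IsManifold.maximalAtlas (𝓡 2) ∞ M) (hs : s ∈ I) (hγs : γ s ∈ φ.source)
    {V W : ℝ → Fin 2 → ℝ} (hV : ∀ i, DifferentiableWithinAt ℝ (fun t => V t i) I s)
    (hW : ∀ i, DifferentiableWithinAt ℝ (fun t => W t i) I s) :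
    HasDerivWithinAt (fun t => coordInner g φ (φ (γ t)) (V t) (W t))
      (coordInner g φ (φ (γ s)) (covDerivAlong g φ γ I V s) (W s) +
        coordInner g φ (φ (γ s)) (V s) (covDerivAlong g φ γ I W s)) I s := by
  have hy := φ.map_source hγs
  have hG : ∀ i j, HasDerivWithinAt (fun t => metricCoeff g φ (φ (γ t)) i j)
      (∑ m, coordVelocity φ γ I s m * partialDeriv m (fun z => metricCoeff g φ z i j) (φ (γ s)))
      I s := by
    intro i j
    have h := ((contDiffOn_metricCoeff g hφ i j).contDiffAt
      (φ.open_target.mem_nhds hy)).differentiableAt (by simp)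
    have h' := h.hasFDerivAt.comp_hasDerivWithinAt s (hγ.hasDerivWithinAt_chart hφ hs hγs)
    rw [fderiv_apply_eq_sum_partialDeriv] at h'
    exact h'
  have h : HasDerivWithinAt (fun t => coordInner g φ (φ (γ t)) (V t) (W t)) _ I s :=
    HasDerivWithinAt.fun_sum (u := Finset.univ) fun i _ =>
      HasDerivWithinAt.fun_sum (u := Finset.univ) fun j _ =>
        ((hG i j).fun_mul (hV i).hasDerivWithinAt).fun_mul (hW j).hasDerivWithinAt
  convert h using 1
  simp only [partialDeriv_metricCoeff g hφ hy, coordInner, covDerivAlong, Fin.sum_univ_two,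
    metricCoeff_symm g _ 1 0]
  ring

end Curves

/-! ### Frenet equations and the Euler–Lagrange equation -/

section CurvatureAlongCurves

variable {M : Type u} [TopologicalSpace M] [ChartedSpace (EuclideanSpace ℝ (Fin 2)) M]
  [IsManifold (𝓡 2) ∞ M]
  {φ : OpenPartialHomeomorph M (EuclideanSpace ℝ (Fin 2))} {g : SmoothRiemannianMetric 2 M}
  {γ : ℝ → M} {I : Set ℝ} {s : ℝ} {y : EuclideanSpace ℝ (Fin 2)}

theorem coordInner_add_left (U V W : Fin 2 → ℝ) :
    coordInner g φ y (U + V) W = coordInner g φ y U W + coordInner g φ y V W := by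
  simp [coordInner, Fin.sum_univ_two]; ring

theorem coordInner_smul_left (c : ℝ) (V W : Fin 2 → ℝ) :
    coordInner g φ y (c • V) W = c * coordInner g φ y V W := by
  simp [coordInner, Fin.sum_univ_two]; ring

theorem coordInner_comm (V W : Fin 2 → ℝ) :
    coordInner g φ y V W = coordInner g φ y W V := by
  simp [coordInner, Fin.sum_univ_two, metricCoeff_symm g y 1 0]; ring

/-- The Gram determinant of (T, N) is det g · det(T, N)² = 1, so T and N are independent and
Cramer's rule applies. -/
theorem eq_zero_of_coordInner_orthonormal {T N Z : Fin 2 → ℝ} (hT : coordInner g φ y T T = 1)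
    (hN : coordInner g φ y N N = 1) (hTN : coordInner g φ y T N = 0)
    (hZT : coordInner g φ y Z T = 0) (hZN : coordInner g φ y Z N = 0) : Z = 0 := by
  simp only [coordInner, Fin.sum_univ_two, metricCoeff_symm g y 1 0] at *
  set a := metricCoeff g φ y 0 0
  set b := metricCoeff g φ y 0 1
  set c := metricCoeff g φ y 1 1
  have h1 : (a * c - b ^ 2) * (T 0 * N 1 - T 1 * N 0) ^ 2 = 1 := by
    linear_combination (a * N 0 * N 0 + b * N 0 * N 1 + (b * N 1 * N 0 + c * N 1 * N 1)) * hT + hN -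
      (a * T 0 * N 0 + b * T 0 * N 1 + (b * T 1 * N 0 + c * T 1 * N 1)) * hTN
  have h2 : (a * c - b ^ 2) * (T 0 * N 1 - T 1 * N 0) ≠ 0 := by
    intro h
    rw [sq (T 0 * N 1 - T 1 * N 0), ← mul_assoc, h, zero_mul] at h1
    exact zero_ne_one h1
  ext i
  fin_cases i
  · refine (mul_eq_zero.1 (?_ : _ * Z 0 = 0)).resolve_left h2
    linear_combination (b * N 0 + c * N 1) * hZT - (b * T 0 + c * T 1) * hZN
  · refine (mul_eq_zero.1 (?_ : _ * Z 1 = 0)).resolve_left h2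
    linear_combination (a * T 0 + b * T 1) * hZN - (a * N 0 + b * N 1) * hZT

/-- On a surface, `R(T, Y) T = -K Y` for a unit vector `T` and a vector `Y` orthogonal to `T`. -/
theorem riemannApply_of_orthogonal (hφ : φ ∈ IsManifold.maximalAtlas (𝓡 2) ∞ M)
    (hy : y ∈ φ.target) {K : ℝ}
    (hK : (∑ l, metricCoeff g φ y 0 l * riemannCoeff g φ l 0 1 1 y) /
      (metricCoeff g φ y).det = K) {T Y : Fin 2 → ℝ}
    (hT : coordInner g φ y T T = 1) (hTY : coordInner g φ y T Y = 0) :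
    riemannApply g φ y T Y T = -K • Y := by
  have hd := (metricCoeff_det_pos g hφ hy).ne'
  rw [div_eq_iff hd] at hK
  have h00 := metricCoeff_mul_riemannCoeff_skew g hφ hy 0 0
  have h01 := metricCoeff_mul_riemannCoeff_skew g hφ hy 0 1
  have h11 := metricCoeff_mul_riemannCoeff_skew g hφ hy 1 1
  -- Antisymmetry in the first two slots leaves only S = R(∂₀, ∂₁), so that R(T, Y)T = det(T, Y) · S
  -- T.
  have hskew : ∀ l k, riemannCoeff g φ l 1 0 k y = -riemannCoeff g φ l 0 1 k y := by
    intro l k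
    simp only [riemannCoeff, Fin.sum_univ_two]
    ring
  have hdiag : ∀ l k i, riemannCoeff g φ l i i k y = 0 := by
    intro l k i
    simp [riemannCoeff]
  rw [Matrix.det_fin_two] at hd hK
  simp only [coordInner, Fin.sum_univ_two, metricCoeff_symm g y 1 0] at *
  set a := metricCoeff g φ y 0 0
  set b := metricCoeff g φ y 0 1
  set c := metricCoeff g φ y 1 1
  set S := fun l k => riemannCoeff g φ l 0 1 k y with hS
  have e : ∀ l, riemannApply g φ y T Y T l =
      (T 0 * Y 1 - T 1 * Y 0) * (S l 0 * T 0 + S l 1 * T 1) := by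
    intro l
    simp only [riemannApply, Fin.sum_univ_two, hskew, hdiag, hS]
    ring
  -- With the upper index lowered, S is a skew 2 × 2 matrix with entries 0 and ±K det g. The two
  -- identities compare the lowered components; the adjugate of g then recovers the vectors.
  have e0 : a * riemannApply g φ y T Y T 0 + b * riemannApply g φ y T Y T 1 =
      -K * (a * Y 0 + b * Y 1) := by
    rw [e, e]
    linear_combination (exp := 1) (T 0 * Y 1 - T 1 * Y 0) * T 1 * hK
      + (T 0 * Y 1 - T 1 * Y 0) * T 0 / 2 * h00
      - K * (a * Y 0 + b * Y 1) * hT + K * (a * T 0 + b * T 1) * hTY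
  have e1 : b * riemannApply g φ y T Y T 0 + c * riemannApply g φ y T Y T 1 =
      -K * (b * Y 0 + c * Y 1) := by
    rw [e, e]
    linear_combination (exp := 1) (T 0 * Y 1 - T 1 * Y 0) * T 0 * (h01 - hK)
      + (T 0 * Y 1 - T 1 * Y 0) * T 1 / 2 * h11
      - K * (b * Y 0 + c * Y 1) * hT + K * (b * T 0 + c * T 1) * hTY
  ext i
  fin_cases i
  · refine mul_left_cancel₀ hd ?_
    simp
    linear_combination c * e0 - b * e1
  · refine mul_left_cancel₀ hd ?_
    simp
    linear_combination a * e1 - b * e0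

theorem IsArclengthCurve.contDiffWithinAt_coordTension (hγ : IsArclengthCurve g γ I)
    (hφ : φ ∈ IsManifold.maximalAtlas (𝓡 2) ∞ M) (hs : s ∈ I) (hγs : γ s ∈ φ.source) (i : Fin 2) :
    ContDiffWithinAt ℝ ∞ (fun t => coordTension g φ γ I t i) I s :=
  hγ.contDiffWithinAt_covDerivAlong hφ hs hγs (hγ.contDiffWithinAt_coordVelocity hφ hs hγs) i

/-- Where k has no zero, N = τ / k is a quotient of smooth functions. -/
theorem IsArclengthCurve.contDiffWithinAt_normal (hγ : IsArclengthCurve g γ I)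
    (hφ : φ ∈ IsManifold.maximalAtlas (𝓡 2) ∞ M) {k : ℝ → ℝ} {N : ℝ → Fin 2 → ℝ}
    (hk : ContDiff ℝ ∞ k) (hk0 : ∀ t, k t ≠ 0)
    (hτ : ∀ t ∈ I, γ t ∈ φ.source → coordTension g φ γ I t = k t • N t)
    (hs : s ∈ I) (hγs : γ s ∈ φ.source) (i : Fin 2) :
    ContDiffWithinAt ℝ ∞ (fun t => N t i) I s := by
  have hN : ∀ t ∈ I, γ t ∈ φ.source → N t i = coordTension g φ γ I t i / k t := by
    intro t ht hγt
    rw [hτ t ht hγt, Pi.smul_apply, smul_eq_mul, mul_div_cancel_left₀ _ (hk0 t)]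
  refine ((hγ.contDiffWithinAt_coordTension hφ hs hγs i).div hk.contDiffWithinAt
    (hk0 s)).congr_of_eventuallyEq ?_ (hN s hs hγs)
  filter_upwards [hγ.eventually_mem_source hs hγs] with t ht using hN t ht.1 ht.2

/-- The Frenet equation `∇_T N = -k T`. -/
theorem IsArclengthCurve.covDerivAlong_normal (hγ : IsArclengthCurve g γ I)
    (hφ : φ ∈ IsManifold.maximalAtlas (𝓡 2) ∞ M) {k : ℝ → ℝ} {N : ℝ → Fin 2 → ℝ}
    (hk : ContDiff ℝ ∞ k) (hk0 : ∀ t, k t ≠ 0)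
    (hτ : ∀ t ∈ I, γ t ∈ φ.source → coordTension g φ γ I t = k t • N t)
    (hN : ∀ t ∈ I, γ t ∈ φ.source → coordInner g φ (φ (γ t)) (N t) (N t) = 1)
    (hTN : ∀ t ∈ I, γ t ∈ φ.source →
      coordInner g φ (φ (γ t)) (coordVelocity φ γ I t) (N t) = 0)
    (hs : s ∈ I) (hγs : γ s ∈ φ.source) :
    covDerivAlong g φ γ I N s = -k s • coordVelocity φ γ I s := by
  have dN := fun i =>
    (hγ.contDiffWithinAt_normal hφ hk hk0 hτ hs hγs i).differentiableWithinAt (by simp)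
  have dT := fun i =>
    (hγ.contDiffWithinAt_coordVelocity hφ hs hγs i).differentiableWithinAt (by simp)
  have hu := hγ.uniqueDiffOn s hs
  have hT1 := hγ.coordInner_coordVelocity hφ hs hγs
  have h1 := (hγ.hasDerivWithinAt_coordInner hφ hs hγs dN dN).derivWithin hu
  have h2 := (hγ.hasDerivWithinAt_coordInner hφ hs hγs dT dN).derivWithin hu
  have e1 : (fun t => coordInner g φ (φ (γ t)) (N t) (N t)) =ᶠ[nhdsWithin s I] fun _ => 1 := by
    filter_upwards [hγ.eventually_mem_source hs hγs] with t ht using hN t ht.1 ht.2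
  have e2 : (fun t => coordInner g φ (φ (γ t)) (coordVelocity φ γ I t) (N t))
      =ᶠ[nhdsWithin s I] fun _ => 0 := by
    filter_upwards [hγ.eventually_mem_source hs hγs] with t ht using hTN t ht.1 ht.2
  rw [e1.derivWithin_eq (hN s hs hγs), derivWithin_fun_const, Pi.zero_apply,
    coordInner_comm (N s)] at h1
  have hτ' : covDerivAlong g φ γ I (coordVelocity φ γ I) s = k s • N s := hτ s hs hγs
  rw [e2.derivWithin_eq (hTN s hs hγs), derivWithin_fun_const, Pi.zero_apply, hτ',
    coordInner_smul_left, hN s hs hγs, coordInner_comm (coordVelocity φ γ I s)] at h2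
  -- Differentiating |N|² = 1 and ⟨T, N⟩ = 0 shows that this vector is orthogonal to both N and T.
  have h3 : covDerivAlong g φ γ I N s + k s • coordVelocity φ γ I s = 0 := by
    apply eq_zero_of_coordInner_orthonormal hT1 (hN s hs hγs) (hTN s hs hγs)
    · rw [coordInner_add_left, coordInner_smul_left, hT1]
      linarith
    · rw [coordInner_add_left, coordInner_smul_left, hTN s hs hγs]
      linarith
  rw [neg_smul]
  exact eq_neg_of_add_eq_zero_left h3

theorem coordNorm_smul_of_unit {c : ℝ} (hc : 0 ≤ c) {N : Fin 2 → ℝ}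
    (hN : coordInner g φ y N N = 1) : coordNorm g φ y (c • N) = c := by
  have : coordInner g φ y (c • N) (c • N) = c ^ 2 := by
    rw [coordInner_smul_left, coordInner_comm, coordInner_smul_left, hN]; ring
  exact (congrArg Real.sqrt this).trans (Real.sqrt_sq hc)

/-- The curvature equation for `r = k ^ (-1/2)`. -/
theorem SolvesCurvatureODE.rpow_neg_half {K : ℝ} {k : ℝ → ℝ} (hk : SolvesCurvatureODE K k)
    (hk0 : ∀ t, 0 < k t) :
    ContDiff ℝ ∞ (fun t => k t ^ (-(1 / 2) : ℝ)) ∧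
    (∀ t, 2 * deriv (fun t => k t ^ (-(1 / 2) : ℝ)) t * k t
      + k t ^ (-(1 / 2) : ℝ) * deriv k t = 0) ∧
    ∀ t, deriv (deriv (fun t => k t ^ (-(1 / 2) : ℝ))) t
      - k t ^ (-(1 / 2) : ℝ) * k t ^ 2 + K * k t ^ (-(1 / 2) : ℝ) = 0 := by
  set r : ℝ → ℝ := fun t => k t ^ (-(1 / 2) : ℝ) with hr
  have cr : ContDiff ℝ ∞ r := hk.1.rpow_const_of_ne fun t => (hk0 t).ne'
  have cr' : ContDiff ℝ ∞ (deriv r) := (contDiff_infty_iff_deriv.1 cr).2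
  have ck' : ContDiff ℝ ∞ (deriv k) := (contDiff_infty_iff_deriv.1 hk.1).2
  have dr : ∀ t, HasDerivAt r (deriv r t) t := fun t =>
    (cr.differentiable (by simp) t).hasDerivAt
  have dr' : ∀ t, HasDerivAt (deriv r) (deriv (deriv r) t) t := fun t =>
    (cr'.differentiable (by simp) t).hasDerivAt
  have dk : ∀ t, HasDerivAt k (deriv k t) t := fun t =>
    (hk.1.differentiable (by simp) t).hasDerivAt
  have dk' : ∀ t, HasDerivAt (deriv k) (deriv (deriv k) t) t := fun t =>
    (ck'.differentiable (by simp) t).hasDerivAt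
  have r0 : ∀ t, 0 < r t := fun t => Real.rpow_pos_of_pos (hk0 t) _
  have h1 : ∀ t, r t * r t * k t = 1 := by
    intro t
    simp only [hr]
    rw [← Real.rpow_add (hk0 t)]
    nth_rewrite 2 [← Real.rpow_one (k t)]
    rw [← Real.rpow_add (hk0 t)]
    norm_num
  have h2 : ∀ t, 2 * deriv r t * k t + r t * deriv k t = 0 := by
    intro t
    have h := ((dr t).fun_mul (dr t)).fun_mul (dk t)
    have h' := h.unique ((hasDerivAt_const t (1 : ℝ)).congr_of_eventuallyEq
      (Filter.Eventually.of_forall h1))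
    refine (mul_eq_zero.1 (?_ : r t * _ = 0)).resolve_left (r0 t).ne'
    linear_combination h'
  have h3 : ∀ t, 2 * deriv (deriv r) t * k t + 3 * deriv r t * deriv k t
      + r t * deriv (deriv k) t = 0 := by
    intro t
    have h := (((dr' t).const_mul 2).fun_mul (dk t)).fun_add ((dr t).fun_mul (dk' t))
    have h' := h.unique ((hasDerivAt_const t (0 : ℝ)).congr_of_eventuallyEq
      (Filter.Eventually.of_forall h2))
    linear_combination h'
  refine ⟨cr, h2, fun t => ?_⟩
  -- The derivatives of r²k = 1 eliminate r' and r'': k² times the claim is r times the curvature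
  -- equation.
  refine (mul_eq_zero.1 (?_ : k t ^ 2 * _ = 0)).resolve_left (pow_pos (hk0 t) 2).ne'
  linear_combination r t * hk.2 t + k t / 2 * h3 t - 3 / 4 * deriv k t * h2 t

/-- A curve of positive geodesic curvature `k` on a surface of constant Gauss curvature `K` is
`½`-biharmonic if `k` solves the curvature equation. -/
theorem IsArclengthCurve.halfBiharmonic_equation (hγ : IsArclengthCurve g γ I)
    (hφ : φ ∈ IsManifold.maximalAtlas (𝓡 2) ∞ M) {K : ℝ} (hK : HasConstantGaussCurvature g K)
    {k : ℝ → ℝ} {N : ℝ → Fin 2 → ℝ}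
    (hk : SolvesCurvatureODE K k) (hk0 : ∀ t, 0 < k t)
    (hτ : ∀ t ∈ I, γ t ∈ φ.source → coordTension g φ γ I t = k t • N t)
    (hN : ∀ t ∈ I, γ t ∈ φ.source → coordInner g φ (φ (γ t)) (N t) (N t) = 1)
    (hTN : ∀ t ∈ I, γ t ∈ φ.source →
      coordInner g φ (φ (γ t)) (coordVelocity φ γ I t) (N t) = 0)
    (hs : s ∈ I) (hγs : γ s ∈ φ.source) :
    coordTension g φ γ I s ≠ 0 ∧
    covDerivAlong g φ γ I
        (covDerivAlong g φ γ I
          (fun t => coordNorm g φ (φ (γ t)) (coordTension g φ γ I t) ^ ((1 / 2 : ℝ) - 2) •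
            coordTension g φ γ I t)) s
      - coordNorm g φ (φ (γ s)) (coordTension g φ γ I s) ^ ((1 / 2 : ℝ) - 2) •
          riemannApply g φ (φ (γ s)) (coordVelocity φ γ I s) (coordTension g φ γ I s)
            (coordVelocity φ γ I s) = 0 := by
  obtain ⟨cr, hr1, hr2⟩ := hk.rpow_neg_half hk0
  -- The exponent p - 2 is -3/2, so |τ|^(p-2) τ = k^(-3/2) k N = k^(-1/2) N.
  have hpow : ∀ t, k t ^ ((1 / 2 : ℝ) - 2) * k t = k t ^ (-(1 / 2) : ℝ) := by
    intro t
    nth_rewrite 2 [← Real.rpow_one (k t)]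
    rw [← Real.rpow_add (hk0 t)]
    norm_num
  set r : ℝ → ℝ := fun t => k t ^ (-(1 / 2) : ℝ) with hr
  have cr' : ContDiff ℝ ∞ (deriv r) := (contDiff_infty_iff_deriv.1 cr).2
  have dk : ∀ t, HasDerivAt k (deriv k t) t := fun t =>
    (hk.1.differentiable (by simp) t).hasDerivAt
  have dr : ∀ t, HasDerivAt r (deriv r t) t := fun t =>
    (cr.differentiable (by simp) t).hasDerivAt
  have dr' : ∀ t, HasDerivAt (deriv r) (deriv (deriv r) t) t := fun t =>
    (cr'.differentiable (by simp) t).hasDerivAt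
  have hk0' := fun t => (hk0 t).ne'
  have dN := fun t (ht : t ∈ I) (hγt : γ t ∈ φ.source) i =>
    (hγ.contDiffWithinAt_normal hφ hk.1 hk0' hτ ht hγt i).differentiableWithinAt (by simp)
  have dT := fun i =>
    (hγ.contDiffWithinAt_coordVelocity hφ hs hγs i).differentiableWithinAt (by simp)
  have hu := hγ.uniqueDiffOn
  have hnorm : ∀ t ∈ I, γ t ∈ φ.source →
      coordNorm g φ (φ (γ t)) (coordTension g φ γ I t) = k t := fun t ht hγt => by
    rw [hτ t ht hγt, coordNorm_smul_of_unit (hk0 t).le (hN t ht hγt)]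
  have hfrenet := fun t ht hγt =>
    hγ.covDerivAlong_normal hφ hk.1 hk0' hτ hN hTN (s := t) ht hγt
  -- The first derivative is needed at all nearby parameters, because it is differentiated again at
  -- s.
  have h1 : ∀ t ∈ I, γ t ∈ φ.source →
      covDerivAlong g φ γ I
          (fun t => coordNorm g φ (φ (γ t)) (coordTension g φ γ I t) ^ ((1 / 2 : ℝ) - 2) •
            coordTension g φ γ I t) t =
        deriv r t • N t + (-(r t * k t)) • coordVelocity φ γ I t := by
    intro t ht hγt
    have e : (fun t => coordNorm g φ (φ (γ t)) (coordTension g φ γ I t) ^ ((1 / 2 : ℝ) - 2) •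
            coordTension g φ γ I t) =ᶠ[nhdsWithin t I] fun t => r t • N t := by
      filter_upwards [hγ.eventually_mem_source ht hγt] with u hu
      rw [hnorm u hu.1 hu.2, hτ u hu.1 hu.2, smul_smul, hpow]
    rw [covDerivAlong_congr e ht,
      covDerivAlong_smul (dr t).differentiableAt.differentiableWithinAt (dN t ht hγt),
      (dr t).hasDerivWithinAt.derivWithin (hu t ht), hfrenet t ht hγt, smul_smul, mul_neg]
  have h2 : covDerivAlong g φ γ I (covDerivAlong g φ γ I
          (fun t => coordNorm g φ (φ (γ t)) (coordTension g φ γ I t) ^ ((1 / 2 : ℝ) - 2) •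
            coordTension g φ γ I t)) s =
      (deriv (deriv r) s • N s + deriv r s • (-k s • coordVelocity φ γ I s)) +
        ((-(deriv r s * k s + r s * deriv k s)) • coordVelocity φ γ I s +
          (-(r s * k s)) • (k s • N s)) := by
    have e : covDerivAlong g φ γ I
          (fun t => coordNorm g φ (φ (γ t)) (coordTension g φ γ I t) ^ ((1 / 2 : ℝ) - 2) •
            coordTension g φ γ I t) =ᶠ[nhdsWithin s I] fun t =>
        deriv r t • N t + (-(r t * k t)) • coordVelocity φ γ I t := by
      filter_upwards [hγ.eventually_mem_source hs hγs] with u hu using h1 u hu.1 hu.2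
    have hrk : HasDerivAt (fun t => -(r t * k t)) (-(deriv r s * k s + r s * deriv k s)) s :=
      ((dr s).fun_mul (dk s)).fun_neg
    have hτ' : covDerivAlong g φ γ I (coordVelocity φ γ I) s = k s • N s := hτ s hs hγs
    have d1 := (dr' s).differentiableAt.differentiableWithinAt (s := I)
    have d2 := hrk.differentiableAt.differentiableWithinAt (s := I)
    rw [covDerivAlong_congr e hs,
      covDerivAlong_add (V := fun t => deriv r t • N t)
        (W := fun t => (-(r t * k t)) • coordVelocity φ γ I t)
        (fun i => d1.fun_mul (dN s hs hγs i)) (fun i => d2.fun_mul (dT i)),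
      covDerivAlong_smul d1 (dN s hs hγs), covDerivAlong_smul d2 dT, hfrenet s hs hγs, hτ',
      (dr' s).hasDerivWithinAt.derivWithin (hu s hs),
      hrk.hasDerivWithinAt.derivWithin (hu s hs)]
  have hN0 : N s ≠ 0 := by
    intro h
    have := hN s hs hγs
    rw [h] at this
    simp [coordInner] at this
  have hTτ : coordInner g φ (φ (γ s)) (coordVelocity φ γ I s) (k s • N s) = 0 := by
    rw [coordInner_comm, coordInner_smul_left, coordInner_comm, hTN s hs hγs, mul_zero]
  refine ⟨by rw [hτ s hs hγs]; exact smul_ne_zero (hk0' s) hN0, ?_⟩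
  rw [h2, hnorm s hs hγs, hτ s hs hγs, riemannApply_of_orthogonal hφ (φ.map_source hγs)
    (hK φ hφ _ (φ.map_source hγs)) (hγ.coordInner_coordVelocity hφ hs hγs) hTτ]
  ext i
  simp only [Pi.add_apply, Pi.sub_apply, Pi.smul_apply, smul_eq_mul, Pi.zero_apply]
  -- The N-part is the equation for r'', the T-part is 2r'k + rk' = 0, and `hpow` rewrites the
  -- curvature term as -KrN.
  linear_combination N s i * hr2 s - coordVelocity φ γ I s i * hr1 s + K * N s i * hpow s

end CurvatureAlongCurves

theorem SolvesCurvatureODE.neg {K : ℝ} {k : ℝ → ℝ} (hk : SolvesCurvatureODE K k) :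
    SolvesCurvatureODE K (fun s => -k s) := by
  have h1 : deriv (fun s => -k s) = fun s => -deriv k s := funext fun s => deriv.fun_neg
  have h2 : deriv (fun s => -deriv k s) = fun s => -deriv (deriv k) s :=
    funext fun s => deriv.fun_neg
  refine ⟨hk.1.neg, fun s => ?_⟩
  rw [h1, h2]
  linear_combination hk.2 s

section Surfaces

variable {M : Type u} [TopologicalSpace M] [ChartedSpace (EuclideanSpace ℝ (Fin 2)) M]
  [IsManifold (𝓡 2) ∞ M] {g : SmoothRiemannianMetric 2 M} {γ : ℝ → M} {I : Set ℝ}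

/-- A continuous k without zeros has constant sign on ℝ, and both τ = kN and the curvature equation
are invariant under (k, N) ↦ (-k, -N). -/
theorem IsArclengthCurve.isPBiharmonicCurve_half (hγ : IsArclengthCurve g γ I) {K : ℝ}
    (hK : HasConstantGaussCurvature g K) {k : ℝ → ℝ} (hk : SolvesCurvatureODE K k)
    (hk0 : ∀ s, k s ≠ 0) (hg : IsGeodesicCurvature g γ I k) :
    IsPBiharmonicCurve (1 / 2) g γ I := by
  obtain ⟨N, -, hN, hTN, hτ⟩ := hg
  intro φ hφ s hs hγs
  set n : ℝ → Fin 2 → ℝ := fun t i =>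
    (show EuclideanSpace ℝ (Fin 2) from mfderiv (𝓡 2) (𝓡 2) φ (γ t) (N t)) i with hn
  have hn1 : ∀ t ∈ I, γ t ∈ φ.source → coordInner g φ (φ (γ t)) (n t) (n t) = 1 :=
    fun t ht hγt => by
      rw [← hN t ht, inner_eq_sum_metricCoeff g hφ hγt]
      rfl
  have hn2 : ∀ t ∈ I, γ t ∈ φ.source →
      coordInner g φ (φ (γ t)) (coordVelocity φ γ I t) (n t) = 0 :=
    fun t ht hγt => by
      rw [← hTN t ht, inner_eq_sum_metricCoeff g hφ hγt, ← hγ.coordVelocity_eq hφ ht hγt]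
      rfl
  have hn3 : ∀ t ∈ I, γ t ∈ φ.source → coordTension g φ γ I t = k t • n t :=
    fun t ht hγt => funext fun i => hτ φ hφ t ht hγt i
  have hsign : (∀ t, 0 < k t) ∨ ∀ t, 0 < -k t := by
    by_contra! h
    obtain ⟨⟨a, ha⟩, b, hb⟩ := h
    obtain ⟨c, hc⟩ := mem_range_of_exists_le_of_exists_ge hk.1.continuous ⟨a, ha⟩
      ⟨b, by linarith⟩
    exact hk0 c hc
  rcases hsign with h | h
  · exact hγ.halfBiharmonic_equation hφ hK hk h hn3 hn1 hn2 hs hγs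
  · refine hγ.halfBiharmonic_equation hφ hK hk.neg h (N := fun t => -n t) ?_ ?_ ?_ hs hγs
    · intro t ht hγt
      rw [hn3 t ht hγt, neg_smul_neg]
    · intro t ht hγt
      rw [← neg_one_smul ℝ (n t), coordInner_smul_left, coordInner_comm, coordInner_smul_left,
        hn1 t ht hγt]
      norm_num
    · intro t ht hγt
      rw [← neg_one_smul ℝ (n t), coordInner_comm, coordInner_smul_left, coordInner_comm,
        hn2 t ht hγt]
      norm_num

end Surfaces

/-! ### The explicit solutions of the curvature equation -/

section CurvatureFunctions

/-- `a / D` solves the curvature equation if `½ D D'' - ¼ D'² + K D² = a²`. -/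
theorem solvesCurvatureODE_const_div {K a : ℝ} {D D' D'' : ℝ → ℝ} (hD0 : ∀ s, D s ≠ 0)
    (hD : ContDiff ℝ ∞ D) (h1 : ∀ s, HasDerivAt D (D' s) s) (h2 : ∀ s, HasDerivAt D' (D'' s) s)
    (h : ∀ s, 1 / 2 * D s * D'' s - 1 / 4 * D' s ^ 2 + K * D s ^ 2 = a ^ 2) :
    SolvesCurvatureODE K (fun s => a / D s) := by
  have e1 : deriv (fun s => a / D s) = fun s => -(a * D' s) / D s ^ 2 := by
    ext s
    have := (hasDerivAt_const s a).fun_div (h1 s) (hD0 s)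
    rw [this.deriv]
    ring
  have e2 : ∀ s, deriv (deriv fun s => a / D s) s =
      -(a * D'' s) / D s ^ 2 + 2 * a * D' s ^ 2 / D s ^ 3 := by
    intro s
    have := (((h2 s).const_mul a).fun_neg).fun_div ((h1 s).fun_pow 2) (pow_ne_zero 2 (hD0 s))
    rw [e1, this.deriv]
    have := hD0 s
    field_simp
    ring
  refine ⟨contDiff_const.div hD hD0, fun s => ?_⟩
  rw [e2, e1]
  have h0 := hD0 s
  field_simp
  linear_combination 8 * a ^ 2 * h s

theorem solvesCurvatureODE_flat {c₁ : ℝ} (c₂ : ℝ) :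
    SolvesCurvatureODE 0 (fun s => c₁ / (c₁ ^ 2 * (c₂ + s) ^ 2 + 1)) := by
  refine solvesCurvatureODE_const_div (D' := fun s => 2 * c₁ ^ 2 * (c₂ + s))
    (D'' := fun _ => 2 * c₁ ^ 2) (fun s => by positivity) (by fun_prop) (fun s => ?_) (fun s => ?_)
    (fun s => by ring)
  · refine (((((hasDerivAt_id' s).const_add c₂).fun_pow 2).const_mul (c₁ ^ 2)).add_const
      1).congr_deriv ?_
    ring
  · refine (((hasDerivAt_id' s).const_add c₂).const_mul (2 * c₁ ^ 2)).congr_deriv ?_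
    ring

/-- The amplitude √(c₁² - 4) is smaller than |c₁|. -/
theorem add_sqrt_mul_sin_ne_zero {c₁ : ℝ} (hc : 4 < c₁ ^ 2) (x : ℝ) :
    c₁ + Real.sqrt (c₁ ^ 2 - 4) * Real.sin x ≠ 0 := by
  intro h
  have h1 := Real.sq_sqrt (by linarith : 0 ≤ c₁ ^ 2 - 4)
  have h2 := Real.sin_sq_add_cos_sq x
  set w := Real.sqrt (c₁ ^ 2 - 4)
  have h3 : c₁ ^ 2 = w ^ 2 * Real.sin x ^ 2 := by
    rw [← mul_pow, eq_neg_of_add_eq_zero_left h, neg_sq]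
  nlinarith [mul_nonneg (sq_nonneg w) (sq_nonneg (Real.cos x))]

theorem hasDerivAt_sin_two_mul (c s : ℝ) :
    HasDerivAt (fun s => Real.sin (2 * (c + s))) (2 * Real.cos (2 * (c + s))) s := by
  refine (((hasDerivAt_id' s).const_add c).const_mul 2).sin.congr_deriv ?_
  ring

theorem solvesCurvatureODE_sphere {c₁ : ℝ} (hc : 4 < c₁ ^ 2) (c₃ : ℝ) :
    SolvesCurvatureODE 1
      (fun s => 2 / (c₁ + Real.sqrt (c₁ ^ 2 - 4) * Real.sin (2 * (c₃ + s)))) := by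
  have h1 := Real.sq_sqrt (by linarith : 0 ≤ c₁ ^ 2 - 4)
  set w := Real.sqrt (c₁ ^ 2 - 4) with hw
  refine solvesCurvatureODE_const_div (D' := fun s => w * (2 * Real.cos (2 * (c₃ + s))))
    (D'' := fun s => w * (-4 * Real.sin (2 * (c₃ + s))))
    (fun s => add_sqrt_mul_sin_ne_zero hc _) ?_ (fun s => ?_) (fun s => ?_) (fun s => ?_)
  · fun_prop
  · exact ((hasDerivAt_sin_two_mul c₃ s).const_mul w).const_add c₁
  · refine (((((hasDerivAt_id' s).const_add c₃).const_mul 2).cos.const_mul 2).const_mul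
      w).congr_deriv ?_
    ring
  · have h2 := Real.sin_sq_add_cos_sq (2 * (c₃ + s))
    linear_combination -w ^ 2 * h2 - h1

theorem solvesCurvatureODE_hyperbolic (c₁ c₄ : ℝ) :
    SolvesCurvatureODE (-1) (fun s => 4 * Real.exp (2 * (c₄ + s)) /
        ((c₁ - Real.exp (2 * (c₄ + s))) ^ 2 + 4)) := by
  -- Dividing by the exponential makes the numerator constant.
  have e : (fun s => 4 * Real.exp (2 * (c₄ + s)) / ((c₁ - Real.exp (2 * (c₄ + s))) ^ 2 + 4)) =
      fun s => 4 / ((c₁ ^ 2 + 4) * Real.exp (-(2 * (c₄ + s))) - 2 * c₁ +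
        Real.exp (2 * (c₄ + s))) := by
    ext s
    rw [Real.exp_neg]
    set E := Real.exp (2 * (c₄ + s))
    have hE : 0 < E := Real.exp_pos _
    have h1 : (c₁ - E) ^ 2 + 4 ≠ 0 := by positivity
    have h2 : (c₁ ^ 2 + 4) * E⁻¹ - 2 * c₁ + E = ((c₁ - E) ^ 2 + 4) / E := by
      field_simp
      ring
    rw [h2]
    field_simp
  rw [e]
  have d1 : ∀ s, HasDerivAt (fun s => Real.exp (2 * (c₄ + s))) (2 * Real.exp (2 * (c₄ + s))) s := by
    intro s
    refine (((hasDerivAt_id' s).const_add c₄).const_mul 2).exp.congr_deriv ?_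
    ring
  have d2 : ∀ s, HasDerivAt (fun s => Real.exp (-(2 * (c₄ + s))))
      (-2 * Real.exp (-(2 * (c₄ + s)))) s := by
    intro s
    refine (((hasDerivAt_id' s).const_add c₄).const_mul 2).fun_neg.exp.congr_deriv ?_
    ring
  have hmul : ∀ s, Real.exp (-(2 * (c₄ + s))) * Real.exp (2 * (c₄ + s)) = 1 := by
    intro s
    rw [← Real.exp_add, neg_add_cancel, Real.exp_zero]
  refine solvesCurvatureODE_const_div
    (D' := fun s => (c₁ ^ 2 + 4) * (-2 * Real.exp (-(2 * (c₄ + s)))) + 2 * Real.exp (2 * (c₄ + s)))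
    (D'' := fun s => (c₁ ^ 2 + 4) * (-2 * (-2 * Real.exp (-(2 * (c₄ + s))))) +
      2 * (2 * Real.exp (2 * (c₄ + s))))
    (fun s => ?_) (by fun_prop) (fun s => ?_) (fun s => ?_) (fun s => ?_)
  · intro h
    have h1 := hmul s
    have h2 := Real.exp_pos (2 * (c₄ + s))
    set E := Real.exp (2 * (c₄ + s))
    -- The product of the denominator with E is (c₁ - E)² + 4 > 0.
    nlinarith [sq_nonneg (c₁ - E)]
  · exact (((d2 s).const_mul _).sub_const _).fun_add (d1 s)
  · exact (((d2 s).const_mul (-2)).const_mul _).fun_add ((d1 s).const_mul 2)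
  · linear_combination 4 * (c₁ ^ 2 + 4) * hmul s

end CurvatureFunctions

/-! ### The geodesic curvature is not constant on I -/

section NonConstancy

variable {I : Set ℝ} {k : ℝ → ℝ}

/-- At an interior point of I, constancy on I becomes constancy of a germ on ℝ, to which the
curvature equation applies. -/
theorem exists_forall_mem_nhds_eq_of_const_on (hI : I.OrdConnected) (hI' : I.Nontrivial)
    {f : ℝ → ℝ} (h : ∀ s ∈ I, ∀ t ∈ I, f s = f t) : ∃ s, s ∈ I ∧ f =ᶠ[nhds s] fun _ => f s := by
  obtain ⟨a, ha, b, hb, hab⟩ := hI'.exists_lt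
  have hm : (a + b) / 2 ∈ Set.Ioo a b := ⟨by linarith, by linarith⟩
  have hsub : Set.Ioo a b ⊆ I := Set.Ioo_subset_Icc_self.trans (hI.out ha hb)
  refine ⟨(a + b) / 2, hsub hm, ?_⟩
  filter_upwards [isOpen_Ioo.mem_nhds hm] with t ht using h _ (hsub ht) _ (hsub hm)

/-- A constant solution of the curvature equation satisfies `k⁴ = K k²`. -/
theorem SolvesCurvatureODE.eq_of_eventuallyEq_const {K : ℝ} (hk : SolvesCurvatureODE K k) {s : ℝ}
    (h : k =ᶠ[nhds s] fun _ => k s) : k s ^ 4 = K * k s ^ 2 := by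
  have h1 : deriv k s = 0 := by rw [h.deriv_eq, deriv_const]
  have h2 : deriv (deriv k) s = 0 := by
    rw [h.deriv.deriv_eq]
    simp
  have := hk.2 s
  rw [h1, h2] at this
  linear_combination -this

theorem SolvesCurvatureODE.exists_ne_of_nonpos {K : ℝ} (hK : K ≤ 0) (hk : SolvesCurvatureODE K k)
    (hk0 : ∀ s, k s ≠ 0) (hI : I.OrdConnected) (hI' : I.Nontrivial) :
    ∃ s ∈ I, ∃ t ∈ I, k s ≠ k t := by
  by_contra! h
  obtain ⟨s, -, hs⟩ := exists_forall_mem_nhds_eq_of_const_on hI hI' h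
  have h1 := hk.eq_of_eventuallyEq_const hs
  have h2 : 0 < k s ^ 2 := by have := hk0 s; positivity
  nlinarith

/-- For K = 1 the equation admits the constants ±1, so the formula for k has to enter. Constancy
forces sin² = 1 and k² = 1 at an interior point, which contradicts w² = c₁² - 4 for the amplitude w.
-/
theorem exists_ne_sphere {c₁ c₃ : ℝ} (hc : 4 < c₁ ^ 2)
    (hk : ∀ s, k s = 2 / (c₁ + Real.sqrt (c₁ ^ 2 - 4) * Real.sin (2 * (c₃ + s))))
    (hI : I.OrdConnected) (hI' : I.Nontrivial) : ∃ s ∈ I, ∃ t ∈ I, k s ≠ k t := by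
  by_contra! h
  obtain ⟨s, -, hs⟩ := exists_forall_mem_nhds_eq_of_const_on hI hI' h
  have hode : SolvesCurvatureODE 1 k := by
    rw [funext hk]
    exact solvesCurvatureODE_sphere hc c₃
  have h1 := hode.eq_of_eventuallyEq_const hs
  have hw := Real.sq_sqrt (by linarith : 0 ≤ c₁ ^ 2 - 4)
  have hD := fun x => add_sqrt_mul_sin_ne_zero hc (2 * (c₃ + x))
  set w := Real.sqrt (c₁ ^ 2 - 4)
  have hw0 : w ≠ 0 := by
    intro h0
    rw [h0] at hw
    linarith
  have hsin : (fun t => Real.sin (2 * (c₃ + t))) =ᶠ[nhds s] fun _ => Real.sin (2 * (c₃ + s)) := by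
    filter_upwards [hs] with t ht
    rw [hk, hk, div_eq_div_iff (hD t) (hD s)] at ht
    refine mul_left_cancel₀ hw0 ?_
    linarith
  have hcos : 2 * Real.cos (2 * (c₃ + s)) = 0 :=
    (hasDerivAt_sin_two_mul c₃ s).unique ((hasDerivAt_const s _).congr_of_eventuallyEq hsin)
  have hsq : Real.sin (2 * (c₃ + s)) ^ 2 = 1 := by
    have := Real.sin_sq_add_cos_sq (2 * (c₃ + s))
    nlinarith
  have hks := hk s
  have hDs := hD s
  set σ := Real.sin (2 * (c₃ + s))
  rw [eq_div_iff hDs] at hks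
  have hk0 : k s ≠ 0 := by
    intro h0
    rw [h0] at hks
    norm_num at hks
  have hk1 : k s ^ 2 = 1 := by
    refine mul_left_cancel₀ (pow_ne_zero 2 hk0) ?_
    linear_combination h1
  have h4 : (c₁ + w * σ) ^ 2 = 4 := by
    calc (c₁ + w * σ) ^ 2 = k s ^ 2 * (c₁ + w * σ) ^ 2 := by rw [hk1, one_mul]
      _ = (k s * (c₁ + w * σ)) ^ 2 := by ring
      _ = 4 := by rw [hks]; norm_num
  -- Expanding (c₁ + wσ)² = 4 with σ² = 1 and c₁² - 4 = w² gives 2w² + 2c₁wσ = 0.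
  have h5 : w = -(c₁ * σ) := by
    refine mul_left_cancel₀ hw0 ?_
    linear_combination 1 / 2 * h4 + 1 / 2 * hw - 1 / 2 * w ^ 2 * hsq
  have h6 : w ^ 2 = c₁ ^ 2 := by rw [h5, neg_sq, mul_pow, hsq, mul_one]
  linarith

end NonConstancy

/-! ### Gauss formula and Gauss equation for a parametrisation -/

section GaussEquation

theorem partialDeriv_finset_sum {m : ℕ} {f : Fin m → EuclideanSpace ℝ (Fin 2) → ℝ}
    {y : EuclideanSpace ℝ (Fin 2)} (i : Fin 2) (hf : ∀ a, DifferentiableAt ℝ (f a) y) :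
    partialDeriv i (fun z => ∑ a, f a z) y = ∑ a, partialDeriv i (f a) y := by
  simp [partialDeriv, fderiv_fun_sum fun a _ => hf a]

theorem partialDeriv_apply {m : ℕ} {X : EuclideanSpace ℝ (Fin 2) → EuclideanSpace ℝ (Fin m)}
    {y : EuclideanSpace ℝ (Fin 2)} (hX : DifferentiableAt ℝ X y) (a : Fin m) (i : Fin 2) :
    partialDeriv i (fun z => X z a) y = fderiv ℝ X y (EuclideanSpace.single i 1) a := by
  have h := ((EuclideanSpace.proj a : EuclideanSpace ℝ (Fin m) →L[ℝ] ℝ).hasFDerivAt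
    (x := X y)).comp y hX.hasFDerivAt
  exact congrArg (fun L => L (EuclideanSpace.single i 1)) h.fderiv

variable {M : Type u} [TopologicalSpace M] [ChartedSpace (EuclideanSpace ℝ (Fin 2)) M]
  [IsManifold (𝓡 2) ∞ M]
  {φ : OpenPartialHomeomorph M (EuclideanSpace ℝ (Fin 2))} {g : SmoothRiemannianMetric 2 M}
  {m : ℕ} {X : EuclideanSpace ℝ (Fin 2) → EuclideanSpace ℝ (Fin m)}
  {y : EuclideanSpace ℝ (Fin 2)}

/-- The tangential part of the second derivatives of a local isometric parametrisation `X` is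
given by the Christoffel symbols. -/
theorem sum_partialDeriv_partialDeriv_mul (hφ : φ ∈ IsManifold.maximalAtlas (𝓡 2) ∞ M)
    (hX : ∀ a, ContDiffOn ℝ ∞ (fun z => X z a) φ.target)
    (hG : ∀ z ∈ φ.target, ∀ i j, metricCoeff g φ z i j =
      ∑ a, partialDeriv i (fun z => X z a) z * partialDeriv j (fun z => X z a) z)
    (hy : y ∈ φ.target) (i j l : Fin 2) :
    ∑ a, partialDeriv i (partialDeriv j (fun z => X z a)) y * partialDeriv l (fun z => X z a) y =
      ∑ p, metricCoeff g φ y l p * christoffel g φ p i j y := by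
  have hU := φ.open_target.mem_nhds hy
  have dX : ∀ a i, DifferentiableAt ℝ (partialDeriv i (fun z => X z a)) y := fun a i =>
    (((hX a).partialDeriv φ.open_target i).contDiffAt hU).differentiableAt (by simp)
  have hD : ∀ k i j, partialDeriv k (fun z => metricCoeff g φ z i j) y =
      ∑ a, partialDeriv k (partialDeriv i (fun z => X z a)) y * partialDeriv j (fun z => X z a) y +
      ∑ a, partialDeriv k (partialDeriv j (fun z => X z a)) y *
        partialDeriv i (fun z => X z a) y := by
    intro k i j
    have e : (fun z => metricCoeff g φ z i j) =ᶠ[nhds y] fun z =>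
        ∑ a, partialDeriv i (fun z => X z a) z * partialDeriv j (fun z => X z a) z := by
      filter_upwards [hU] with z hz using hG z hz i j
    rw [partialDeriv_congr k e, partialDeriv_finset_sum k fun a => (dX a i).fun_mul (dX a j),
      ← Finset.sum_add_distrib]
    refine Finset.sum_congr rfl fun a _ => ?_
    rw [partialDeriv_mul k (dX a i) (dX a j)]
    ring
  have hcomm : ∀ a i j, partialDeriv i (partialDeriv j (fun z => X z a)) y =
      partialDeriv j (partialDeriv i (fun z => X z a)) y := fun a i j =>
    ((hX a).contDiffAt hU).partialDeriv_comm i j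
  -- Each derivative of g splits into two sums; since mixed partials agree, four of the six cancel
  -- and the other two are equal.
  rw [sum_metricCoeff_mul_christoffel g hφ hy, hD, hD, hD]
  simp only [hcomm _ j i, hcomm _ l i, hcomm _ l j]
  ring

/-- The Gauss formula for a local isometric parametrisation `X` of a surface, flat if `κ = 0` and
on the unit sphere if `κ = 1`. -/
theorem partialDeriv_partialDeriv_parametrization
    (hφ : φ ∈ IsManifold.maximalAtlas (𝓡 2) ∞ M)
    (hX : ∀ a, ContDiffOn ℝ ∞ (fun z => X z a) φ.target)
    (hG : ∀ z ∈ φ.target, ∀ i j, metricCoeff g φ z i j =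
      ∑ a, partialDeriv i (fun z => X z a) z * partialDeriv j (fun z => X z a) z)
    {κ : ℝ} (hκ : κ ^ 2 = κ) (hnorm : ∀ z ∈ φ.target, κ * ∑ a, X z a * X z a = κ)
    (horth : ∀ z ∈ φ.target, ∀ l, κ * ∑ a, X z a * partialDeriv l (fun z => X z a) z = 0)
    (hspan : ∀ z ∈ φ.target, ∀ v : EuclideanSpace ℝ (Fin m),
      (∀ l, ∑ a, v a * partialDeriv l (fun z => X z a) z = 0) →
      κ * ∑ a, v a * X z a = 0 → v = 0)
    (hy : y ∈ φ.target) (i j : Fin 2) (a : Fin m) :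
    partialDeriv i (partialDeriv j (fun z => X z a)) y =
      ∑ p, christoffel g φ p i j y * partialDeriv p (fun z => X z a) y
        - κ * metricCoeff g φ y i j * X y a := by
  have hU := φ.open_target.mem_nhds hy
  have dX : ∀ a, DifferentiableAt ℝ (fun z => X z a) y := fun a =>
    ((hX a).contDiffAt hU).differentiableAt (by simp)
  have dX' : ∀ a i, DifferentiableAt ℝ (partialDeriv i (fun z => X z a)) y := fun a i =>
    (((hX a).partialDeriv φ.open_target i).contDiffAt hU).differentiableAt (by simp)
  -- Obtained by differentiating the orthogonality of X and ∂ⱼX; for κ = 0 it is vacuous.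
  have hnormal : κ * ∑ a, partialDeriv i (partialDeriv j (fun z => X z a)) y * X y a =
      -(κ * metricCoeff g φ y i j) := by
    have e : (fun z => ∑ a, κ * (X z a * partialDeriv j (fun z => X z a) z)) =ᶠ[nhds y]
        fun _ => 0 := by
      filter_upwards [hU] with z hz
      rw [← Finset.mul_sum]
      exact horth z hz j
    have h := partialDeriv_congr i e
    have d1 : ∀ a, DifferentiableAt ℝ
        (fun z => X z a * partialDeriv j (fun z => X z a) z) y := fun a => (dX a).mul (dX' a j)
    have h0 : partialDeriv i (fun _ => 0) y = 0 := by simp [partialDeriv]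
    rw [partialDeriv_finset_sum i fun a => (d1 a).const_mul κ, h0] at h
    have h1 : ∀ a, partialDeriv i (fun z => κ * (X z a * partialDeriv j (fun z => X z a) z)) y =
        κ * (partialDeriv i (fun z => X z a) y * partialDeriv j (fun z => X z a) y) +
        κ * (partialDeriv i (partialDeriv j (fun z => X z a)) y * X y a) := by
      intro a
      rw [partialDeriv_mul i (differentiableAt_const κ) (d1 a),
        partialDeriv_mul i (dX a) (dX' a j)]
      have : partialDeriv i (fun _ => κ) y = 0 := by simp [partialDeriv]
      rw [this]
      ring
    simp only [h1, Finset.sum_add_distrib, ← Finset.mul_sum] at h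
    rw [hG y hy]
    linear_combination h
  have htan := sum_partialDeriv_partialDeriv_mul hφ hX hG hy i j
  have ho := horth y hy
  have hn := hnorm y hy
  -- The difference of the two sides is orthogonal to every ∂ₗX and, if κ = 1, to X; hence it
  -- vanishes by `hspan`.
  have hz := hspan y hy (WithLp.toLp 2 fun a =>
    partialDeriv i (partialDeriv j (fun z => X z a)) y -
      (christoffel g φ 0 i j y * partialDeriv 0 (fun z => X z a) y +
        christoffel g φ 1 i j y * partialDeriv 1 (fun z => X z a) y)
      + κ * metricCoeff g φ y i j * X y a) ?_ ?_
  · have := congrArg (fun v : EuclideanSpace ℝ (Fin m) => v a) hz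
    simp only [PiLp.zero_apply] at this
    rw [Fin.sum_univ_two]
    linear_combination this
  · intro l
    have h1 := htan l
    simp only [Fin.sum_univ_two, metricCoeff_symm g y l, hG y hy _ l] at h1
    have h2 := ho l
    simp only [add_mul, sub_mul, mul_assoc, Finset.sum_add_distrib, Finset.sum_sub_distrib,
      ← Finset.mul_sum]
    linear_combination h1 + metricCoeff g φ y i j * h2
  · have h0 := ho 0
    have h1 := ho 1
    simp only [add_mul, sub_mul, mul_assoc, Finset.sum_add_distrib, Finset.sum_sub_distrib,
      ← Finset.mul_sum]
    simp only [mul_comm (X y _) (partialDeriv _ _ _)] at h0 h1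
    linear_combination hnormal - christoffel g φ 0 i j y * h0 - christoffel g φ 1 i j y * h1
      + κ * metricCoeff g φ y i j * hn + metricCoeff g φ y i j * hκ

/-- The Gauss equation: the curvature of a surface with the local isometric parametrisation `X`. -/
theorem gaussCurvature_of_parametrization
    (hφ : φ ∈ IsManifold.maximalAtlas (𝓡 2) ∞ M)
    (hX : ∀ a, ContDiffOn ℝ ∞ (fun z => X z a) φ.target)
    (hG : ∀ z ∈ φ.target, ∀ i j, metricCoeff g φ z i j =
      ∑ a, partialDeriv i (fun z => X z a) z * partialDeriv j (fun z => X z a) z)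
    {κ : ℝ} (hκ : κ ^ 2 = κ) (hnorm : ∀ z ∈ φ.target, κ * ∑ a, X z a * X z a = κ)
    (hspan : ∀ z ∈ φ.target, ∀ v : EuclideanSpace ℝ (Fin m),
      (∀ l, ∑ a, v a * partialDeriv l (fun z => X z a) z = 0) →
      κ * ∑ a, v a * X z a = 0 → v = 0)
    (hy : y ∈ φ.target) :
    (∑ l, metricCoeff g φ y 0 l * riemannCoeff g φ l 0 1 1 y) / (metricCoeff g φ y).det = κ := by
  have hU : ∀ z ∈ φ.target, φ.target ∈ nhds z := fun z hz => φ.open_target.mem_nhds hz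
  have dX : ∀ z ∈ φ.target, ∀ a, DifferentiableAt ℝ (fun z => X z a) z := fun z hz a =>
    ((hX a).contDiffAt (hU z hz)).differentiableAt (by simp)
  have horth : ∀ z ∈ φ.target, ∀ l,
      κ * ∑ a, X z a * partialDeriv l (fun z => X z a) z = 0 := by
    intro z hz l
    have e : (fun z => ∑ a, κ * (X z a * X z a)) =ᶠ[nhds z] fun _ => κ := by
      filter_upwards [hU z hz] with w hw
      rw [← Finset.mul_sum]
      exact hnorm w hw
    have h := partialDeriv_congr l e
    have hc : partialDeriv l (fun _ => κ) z = 0 := by simp [partialDeriv]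
    have d1 : ∀ a, DifferentiableAt ℝ (fun z => X z a * X z a) z :=
      fun a => (dX z hz a).mul (dX z hz a)
    rw [partialDeriv_finset_sum l fun a => (d1 a).const_mul κ, hc] at h
    have h1 : ∀ a, partialDeriv l (fun z => κ * (X z a * X z a)) z =
        2 * (κ * (X z a * partialDeriv l (fun z => X z a) z)) := by
      intro a
      rw [partialDeriv_mul l (differentiableAt_const κ) (d1 a),
        partialDeriv_mul l (dX z hz a) (dX z hz a), hc]
      ring
    simp only [h1, ← Finset.mul_sum] at h
    linarith
  have key := fun z (hz : z ∈ φ.target) =>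
    partialDeriv_partialDeriv_parametrization hφ hX hG hκ hnorm horth hspan hz
  have dX' : ∀ a i, DifferentiableAt ℝ (partialDeriv i (fun z => X z a)) y := fun a i =>
    (((hX a).partialDeriv φ.open_target i).contDiffAt (hU y hy)).differentiableAt (by simp)
  have dG : ∀ i j, DifferentiableAt ℝ (fun z => metricCoeff g φ z i j) y := fun i j =>
    ((contDiffOn_metricCoeff g hφ i j).contDiffAt (hU y hy)).differentiableAt (by simp)
  have dΓ : ∀ k i j, DifferentiableAt ℝ (fun z => christoffel g φ k i j z) y := fun k i j =>
    ((contDiffOn_christoffel g hφ k i j).contDiffAt (hU y hy)).differentiableAt (by simp)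
  have h3 : ∀ i j k a, partialDeriv i (partialDeriv j (partialDeriv k (fun z => X z a))) y =
      (partialDeriv i (fun z => christoffel g φ 0 j k z) y * partialDeriv 0 (fun z => X z a) y +
        christoffel g φ 0 j k y * partialDeriv i (partialDeriv 0 (fun z => X z a)) y) +
      (partialDeriv i (fun z => christoffel g φ 1 j k z) y * partialDeriv 1 (fun z => X z a) y +
        christoffel g φ 1 j k y * partialDeriv i (partialDeriv 1 (fun z => X z a)) y) +
      -κ * (partialDeriv i (fun z => metricCoeff g φ z j k) y * X y a +
        metricCoeff g φ y j k * partialDeriv i (fun z => X z a) y) := by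
    intro i j k a
    have e : partialDeriv j (partialDeriv k (fun z => X z a)) =ᶠ[nhds y] fun z =>
        christoffel g φ 0 j k z * partialDeriv 0 (fun z => X z a) z +
          christoffel g φ 1 j k z * partialDeriv 1 (fun z => X z a) z +
          -κ * (metricCoeff g φ z j k * X z a) := by
      filter_upwards [hU y hy] with z hz
      rw [key z hz, Fin.sum_univ_two]
      ring
    have d0 := (dΓ 0 j k).fun_mul (dX' a 0)
    have d1 := (dΓ 1 j k).fun_mul (dX' a 1)
    have d2 := (dG j k).fun_mul (dX y hy a)
    have hc : partialDeriv i (fun _ => -κ) y = 0 := by simp [partialDeriv]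
    rw [partialDeriv_congr i e, partialDeriv_add i (d0.fun_add d1) (d2.const_mul _),
      partialDeriv_add i d0 d1, partialDeriv_mul i (differentiableAt_const _) d2,
      partialDeriv_mul i (dΓ 0 j k) (dX' a 0), partialDeriv_mul i (dΓ 1 j k) (dX' a 1),
      partialDeriv_mul i (dG j k) (dX y hy a), hc]
    ring
  -- Compare ∂₀∂₁∂₁X with ∂₁∂₀∂₁X and insert the Gauss formula. C collects the coefficient of X; its
  -- value is immaterial because X is orthogonal to ∂₀X when κ ≠ 0.
  obtain ⟨C, hC⟩ : ∃ C : ℝ, ∀ a, riemannCoeff g φ 0 0 1 1 y * partialDeriv 0 (fun z => X z a) y +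
      riemannCoeff g φ 1 0 1 1 y * partialDeriv 1 (fun z => X z a) y -
      κ * metricCoeff g φ y 1 1 * partialDeriv 0 (fun z => X z a) y +
      κ * metricCoeff g φ y 0 1 * partialDeriv 1 (fun z => X z a) y - κ * C * X y a = 0 := by
    refine ⟨partialDeriv 0 (fun z => metricCoeff g φ z 1 1) y -
      partialDeriv 1 (fun z => metricCoeff g φ z 0 1) y +
      (christoffel g φ 0 1 1 y * metricCoeff g φ y 0 0 +
        christoffel g φ 1 1 1 y * metricCoeff g φ y 0 1) -
      (christoffel g φ 0 0 1 y * metricCoeff g φ y 1 0 +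
        christoffel g φ 1 0 1 y * metricCoeff g φ y 1 1), fun a => ?_⟩
    have hc := (((hX a).partialDeriv φ.open_target 1).contDiffAt (hU y hy)).partialDeriv_comm 0 1
    rw [h3, h3] at hc
    simp only [key y hy, Fin.sum_univ_two] at hc
    simp only [riemannCoeff, Fin.sum_univ_two]
    linear_combination hc
  -- Pairing with ∂₀X isolates g(R(∂₀, ∂₁)∂₁, ∂₀) = κ det g.
  have hsum : ∑ a, (riemannCoeff g φ 0 0 1 1 y * partialDeriv 0 (fun z => X z a) y +
      riemannCoeff g φ 1 0 1 1 y * partialDeriv 1 (fun z => X z a) y -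
      κ * metricCoeff g φ y 1 1 * partialDeriv 0 (fun z => X z a) y +
      κ * metricCoeff g φ y 0 1 * partialDeriv 1 (fun z => X z a) y - κ * C * X y a) *
      partialDeriv 0 (fun z => X z a) y = 0 :=
    Finset.sum_eq_zero fun a _ => by rw [hC a, zero_mul]
  simp only [add_mul, sub_mul, mul_assoc, Finset.sum_add_distrib, Finset.sum_sub_distrib,
      ← Finset.mul_sum] at hsum
  rw [← hG y hy, ← hG y hy] at hsum
  rw [div_eq_iff (metricCoeff_det_pos g hφ hy).ne', Matrix.det_fin_two, Fin.sum_univ_two,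
    metricCoeff_symm g y 0 1]
  rw [metricCoeff_symm g y 0 1] at hsum
  linear_combination hsum + C * horth y hy 0

end GaussEquation

/-! ### Curvature of the plane and of the sphere -/

section ModelSurfaces

theorem coord_inner_eq_sum {m : ℕ} (v w : EuclideanSpace ℝ (Fin m)) :
    inner ℝ v w = ∑ a, v a * w a := by
  simp [PiLp.inner_apply, mul_comm]

/-- If all partial derivatives of `X` are orthogonal to `v`, so is the image of its derivative. -/
theorem inner_fderiv_eq_zero {m : ℕ} {X : EuclideanSpace ℝ (Fin 2) → EuclideanSpace ℝ (Fin m)}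
    {z : EuclideanSpace ℝ (Fin 2)} (hX : DifferentiableAt ℝ X z) {v : EuclideanSpace ℝ (Fin m)}
    (h : ∀ l, ∑ a, v a * partialDeriv l (fun z => X z a) z = 0) (u : EuclideanSpace ℝ (Fin 2)) :
    inner ℝ v (fderiv ℝ X z u) = 0 := by
  have hu : u = ∑ i, u i • EuclideanSpace.single i (1 : ℝ) := by
    ext j; fin_cases j <;> simp
  have h' : ∀ l, inner ℝ v (fderiv ℝ X z (EuclideanSpace.single l 1)) = 0 := fun l => by
    rw [coord_inner_eq_sum, ← h l]
    simp only [partialDeriv_apply hX]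
  rw [hu]
  simp only [map_sum, map_smul, inner_sum, inner_smul_right, h', mul_zero, Finset.sum_const_zero]

/-- The inverse of any chart is itself an isometric parametrisation, with κ = 0; its differential is
onto, so a vector orthogonal to all ∂ₗX is orthogonal to itself. -/
theorem hasConstantGaussCurvature_flatMetric : HasConstantGaussCurvature flatMetric 0 := by
  intro φ hφ y hy
  have hX : ContDiffOn ℝ ∞ φ.symm φ.target :=
    contMDiffOn_iff_contDiffOn.1 (contMDiffOn_symm_of_mem_maximalAtlas hφ)
  have dX : ∀ z ∈ φ.target, DifferentiableAt ℝ φ.symm z := fun z hz =>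
    (hX.contDiffAt (φ.open_target.mem_nhds hz)).differentiableAt (by simp)
  refine gaussCurvature_of_parametrization (X := φ.symm) hφ (fun a => contDiffOn_euclidean.1 hX a)
    ?_ (by norm_num) (by simp) ?_ hy
  · intro z hz i j
    simp only [partialDeriv_apply (dX z hz)]
    rw [← coord_inner_eq_sum]
    have : ∀ i, coordField φ z i = fderiv ℝ φ.symm z (EuclideanSpace.single i 1) := fun i => by
      rw [coordField, mfderiv_eq_fderiv]
      rfl
    simp only [metricCoeff, Matrix.of_apply, this]
    rfl
  · intro z hz v hv _
    have hsurj := (mdifferentiable_of_mem_maximalAtlas hφ).symm.mfderiv_surjective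
      (x := z) hz
    obtain ⟨u, hu⟩ := hsurj v
    have hu' : fderiv ℝ φ.symm z u = v := by
      rw [← mfderiv_eq_fderiv]
      exact hu
    have := inner_fderiv_eq_zero (dX z hz) hv u
    rw [hu'] at this
    exact inner_self_eq_zero.1 this

theorem hasConstantGaussCurvature_roundMetric : HasConstantGaussCurvature roundMetric 1 := by
  intro φ hφ y hy
  have := Fact.mk (@finrank_euclideanSpace_fin ℝ _ (2 + 1))
  have hc : ContMDiff (𝓡 2) 𝓘(ℝ, EuclideanSpace ℝ (Fin 3)) ∞
      (fun x : TwoSphere => (x : EuclideanSpace ℝ (Fin 3))) :=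
    contMDiff_coe_sphere (n := 2)
  set X : EuclideanSpace ℝ (Fin 2) → EuclideanSpace ℝ (Fin 3) := fun z => φ.symm z with hXdef
  have hX : ContDiffOn ℝ ∞ X φ.target :=
    contMDiffOn_iff_contDiffOn.1
      (hc.comp_contMDiffOn (contMDiffOn_symm_of_mem_maximalAtlas hφ))
  have dX : ∀ z ∈ φ.target, DifferentiableAt ℝ X z := fun z hz =>
    (hX.contDiffAt (φ.open_target.mem_nhds hz)).differentiableAt (by simp)
  have hd : ∀ z ∈ φ.target, ∀ u : EuclideanSpace ℝ (Fin 2), fderiv ℝ X z u =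
      sphereInclusionDeriv (φ.symm z) (mfderiv (𝓡 2) (𝓡 2) φ.symm z u) := by
    intro z hz u
    have h := mfderiv_comp z (hc.mdifferentiableAt (by simp))
      ((mdifferentiable_of_mem_maximalAtlas hφ).mdifferentiableAt_symm hz)
    rw [← mfderiv_eq_fderiv]
    exact congrArg (fun L => L u) h
  have hn : ∀ z, ∑ a, X z a * X z a = 1 := fun z => by
    rw [← coord_inner_eq_sum, real_inner_self_eq_norm_sq, norm_eq_of_mem_sphere, one_pow]
  refine gaussCurvature_of_parametrization (X := X) hφ (fun a => contDiffOn_euclidean.1 hX a)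
    ?_ (by norm_num) (fun z _ => by rw [hn, one_mul]) ?_ hy
  · intro z hz i j
    simp only [partialDeriv_apply (dX z hz)]
    rw [← coord_inner_eq_sum, hd z hz, hd z hz]
    rfl
  · intro z hz v hv hv'
    rw [one_mul, ← coord_inner_eq_sum] at hv'
    have hsurj := (mdifferentiable_of_mem_maximalAtlas hφ).symm.mfderiv_surjective
      (x := z) hz
    -- The tangent plane of the sphere is the orthogonal complement of X, so v lies in the image of
    -- dX; being orthogonal to that image, it vanishes.
    have hvx : v ∈ (Submodule.span ℝ {X z})ᗮ := by
      rw [Submodule.mem_orthogonal_singleton_iff_inner_left]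
      exact hv'
    have hvr : v ∈ (mvfderiv (𝓡 2) ((↑) : TwoSphere → EuclideanSpace ℝ (Fin 3))
        (φ.symm z)).range := by
      rw [range_mvfderiv_subtypeVal (n := 2) (φ.symm z)]
      exact hvx
    obtain ⟨w, hw⟩ := hvr
    obtain ⟨u, hu⟩ := hsurj w
    have hu' : fderiv ℝ X z u = v :=
      (hd z hz u).trans ((congrArg (sphereInclusionDeriv (φ.symm z)) hu).trans hw)
    have := inner_fderiv_eq_zero (dX z hz) hv u
    rw [hu'] at this
    exact inner_self_eq_zero.1 this

end ModelSurfaces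

end

/-! ### The three families -/

theorem mainTheorem1 :
    -- the Euclidean plane
    (∀ (γ : ℝ → EuclideanSpace ℝ (Fin 2)) (I : Set ℝ) (c₁ c₂ : ℝ) (k : ℝ → ℝ),
      IsArclengthCurve flatMetric γ I → c₁ ≠ 0 →
      (∀ s, k s = c₁ / (c₁ ^ 2 * (c₂ + s) ^ 2 + 1)) →
      SolvesCurvatureODE 0 k ∧
        (IsGeodesicCurvature flatMetric γ I k → IsProperHalfBiharmonicCurve flatMetric γ I)) ∧
    -- the round sphere
    (∀ (γ : ℝ → TwoSphere) (I : Set ℝ) (c₁ c₃ : ℝ) (k : ℝ → ℝ),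
      IsArclengthCurve roundMetric γ I → 4 < c₁ ^ 2 →
      (∀ s, k s = 2 / (c₁ + Real.sqrt (c₁ ^ 2 - 4) * Real.sin (2 * (c₃ + s)))) →
      SolvesCurvatureODE 1 k ∧
        (IsGeodesicCurvature roundMetric γ I k → IsProperHalfBiharmonicCurve roundMetric γ I)) ∧
    -- hyperbolic surfaces
    (∀ (M : Type u) [TopologicalSpace M] [ChartedSpace (EuclideanSpace ℝ (Fin 2)) M]
      [IsManifold (𝓡 2) ∞ M] (g : SmoothRiemannianMetric 2 M),
      HasConstantGaussCurvature g (-1) →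
      ∀ (γ : ℝ → M) (I : Set ℝ) (c₁ c₄ : ℝ) (k : ℝ → ℝ),
      IsArclengthCurve g γ I →
      (∀ s, k s = 4 * Real.exp (2 * (c₄ + s)) /
        ((c₁ - Real.exp (2 * (c₄ + s))) ^ 2 + 4)) →
      SolvesCurvatureODE (-1) k ∧
        (IsGeodesicCurvature g γ I k → IsProperHalfBiharmonicCurve g γ I)) := by
  refine ⟨fun γ I c₁ c₂ k hγ hc hk => ?_, fun γ I c₁ c₃ k hγ hc hk => ?_, fun M _ _ _ g hK γ I c₁ c₄ k
    hγ hk => ?_⟩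
  · have hode : SolvesCurvatureODE 0 k := by
      rw [funext hk]
      exact solvesCurvatureODE_flat c₂
    have hk0 : ∀ s, k s ≠ 0 := fun s => by
      rw [hk]
      exact div_ne_zero hc (by positivity)
    exact ⟨hode, fun hg =>
      ⟨hγ.isPBiharmonicCurve_half hasConstantGaussCurvature_flatMetric hode hk0 hg, k, hg,
        hode.exists_ne_of_nonpos le_rfl hk0 hγ.ordConnected hγ.nontrivial⟩⟩
  · have hode : SolvesCurvatureODE 1 k := by
      rw [funext hk]
      exact solvesCurvatureODE_sphere hc c₃
    have hk0 : ∀ s, k s ≠ 0 := fun s => by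
      rw [hk]
      exact div_ne_zero two_ne_zero (add_sqrt_mul_sin_ne_zero hc _)
    exact ⟨hode, fun hg =>
      ⟨hγ.isPBiharmonicCurve_half hasConstantGaussCurvature_roundMetric hode hk0 hg, k, hg,
        exists_ne_sphere hc hk hγ.ordConnected hγ.nontrivial⟩⟩
  · have hode : SolvesCurvatureODE (-1) k := by
      rw [funext hk]
      exact solvesCurvatureODE_hyperbolic c₁ c₄
    have hk0 : ∀ s, k s ≠ 0 := fun s => by
      rw [hk]
      positivity
    exact ⟨hode, fun hg =>
      ⟨hγ.isPBiharmonicCurve_half hK hode hk0 hg, k, hg,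
        hode.exists_ne_of_nonpos (by norm_num) hk0 hγ.ordConnected hγ.nontrivial⟩⟩
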